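/- Let $\gamma\in(0,1)$, $\alpha=1+\gamma$, and let $\Lambda$ be a homogeneous symmetric $\alpha$-stable random measure on $\mathbb R^2$, i.e. an independently scattered random measure defined on the Borel sets $A$ of finite Lebesgue measure $|A|$, with $\mathbb E\,e^{i\theta\Lambda(A)}=e^{-|A||\theta|^\alpha}$ for all $\theta\in\mathbb R$. Let $g:[0,\infty)\to[0,\infty)$ be continuous, integrable, strictly decreasing, continuously differentiable on $(0,\infty)$, with $\lim_{x\to\infty}x^{2+\gamma}|g'(x)|=C_g$ for some $C_g>0$ (this is assumption (G)). Put $A_t=\{(x,y): x\le t,\ 0\le y\le g(t-x)\}$, let $X=(X_t)_{t\ge0}$ be a jointly measurable version of the trawl process, $X_t=\Lambda(A_t)$ a.s. for every $t\ge 0$, and let $$Y_T(t)=\frac1{F_T}\int_0^{Tt}X_s\,ds,\quad t\ge0,\qquad F_T=(T\log T)^{1/\alpha}.$$ Then almost surely $X$ is integrable on every bounded interval (so that $Y_T$ is well defined), and there is a finite constant $K>0$ such that, as $T\to\infty$, the processes $Y_T$ converge in the sense of finite-dimensional distributions to $K\xi^{(\alpha)}$, where $\xi^{(\alpha)}$ is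 a symmetric $\alpha$-stable Lévy process, i.e. $\xi^{(\alpha)}_0=0$ a.s., $\xi^{(\alpha)}$ has independent increments, and $\mathbb E\,e^{i\theta(\xi^{(\alpha)}_t-\xi^{(\alpha)}_s)}=e^{-(t-s)|\theta|^\alpha}$ for $0\le s\le t$, $\theta\in\mathbb R$ (such processes exist). -/

import Mathlib

open MeasureTheory ProbabilityTheory Filter Topology
open scoped NNReal ENNReal

noncomputable section

namespace Trawl

/-- A symmetric Lévy measure on the real line: no atom at the origin,
`∫ (1 ∧ y²) ν(dy) < ∞`, and invariance under `y ↦ -y`. -/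
structure IsSymmetricLevyMeasure (ν : Measure ℝ) : Prop where
  zero_atom : ν {0} = 0
  lintegral_lt_top : ∫⁻ y, ENNReal.ofReal (min 1 (y ^ 2)) ∂ν < ⊤
  symmetric : ν.map (fun y => -y) = ν

/-- The Lévy exponent `ψ(θ) = ∫ (1 - cos (θ y)) ν(dy)` of a symmetric Lévy measure. -/
def levyExponent (ν : Measure ℝ) (θ : ℝ) : ℝ :=
  ∫ y, (1 - Real.cos (θ * y)) ∂ν

/-- A homogeneous Lévy basis on `ℝ²` with symmetric Lévy measure `ν`, without drift and without
Gaussian part.  Only the values of `Λ` on Borel sets of finite Lebesgue measure matter. -/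
structure IsLevyBasis {Ω : Type*} [MeasurableSpace Ω] (P : Measure Ω) (ν : Measure ℝ)
    (Λ : Set (ℝ × ℝ) → Ω → ℝ) : Prop where
  levyMeasure : IsSymmetricLevyMeasure ν
  measurable : ∀ A : Set (ℝ × ℝ), MeasurableSet A → volume A < ⊤ → Measurable (Λ A)
  /-- Values on pairwise disjoint sets are independent. -/
  indep : ∀ A : ℕ → Set (ℝ × ℝ), (∀ n, MeasurableSet (A n)) → (∀ n, volume (A n) < ⊤) →
    Pairwise (fun i j => Disjoint (A i) (A j)) → iIndepFun (fun n => Λ (A n)) P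
  /-- Countable additivity: the series of values converges almost surely (as a limit of
  partial sums) to the value on the union. -/
  additive : ∀ A : ℕ → Set (ℝ × ℝ), (∀ n, MeasurableSet (A n)) → (∀ n, volume (A n) < ⊤) →
    Pairwise (fun i j => Disjoint (A i) (A j)) → volume (⋃ n, A n) < ⊤ →
    ∀ᵐ ω ∂P, Tendsto (fun N : ℕ => ∑ n ∈ Finset.range N, Λ (A n) ω) atTop
      (𝓝 (Λ (⋃ n, A n) ω))
  /-- `𝔼 exp(i θ Λ(A)) = exp(-|A| ψ(θ))`. -/
  charFun_eq : ∀ A : Set (ℝ × ℝ), MeasurableSet A → volume A < ⊤ → ∀ θ : ℝ,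
    charFun (P.map (Λ A)) θ =
      ((Real.exp (-((volume A).toReal * levyExponent ν θ)) : ℝ) : ℂ)

/-- A (homogeneous) symmetric `α`-stable random measure on `ℝ²`: a Lévy basis whose
Lévy exponent is `ψ(θ) = |θ|^α`. -/
def IsSymmetricStableRandomMeasure {Ω : Type*} [MeasurableSpace Ω] (P : Measure Ω) (α : ℝ)
    (Λ : Set (ℝ × ℝ) → Ω → ℝ) : Prop :=
  ∃ ν : Measure ℝ, IsLevyBasis P ν Λ ∧ ∀ θ : ℝ, levyExponent ν θ = |θ| ^ α

/-- The assumption on the trawl function `g : [0,∞) → [0,∞)`; the values of `g` on `(-∞,0)`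
play no role. -/
structure AssumptionG (g : ℝ → ℝ) (γ Cg : ℝ) : Prop where
  gamma_pos : 0 < γ
  gamma_lt_one : γ < 1
  const_pos : 0 < Cg
  nonneg : ∀ x, 0 ≤ x → 0 ≤ g x
  continuousOn : ContinuousOn g (Set.Ici 0)
  integrableOn : IntegrableOn g (Set.Ici 0)
  strictAntiOn : StrictAntiOn g (Set.Ici 0)
  contDiffOn : ContDiffOn ℝ 1 g (Set.Ioi 0)
  tendsto_deriv : Tendsto (fun x : ℝ => x ^ (2 + γ) * |deriv g x|) atTop (𝓝 Cg)

/-- The trawl set `A_t = {(x, y) : x ≤ t, 0 ≤ y ≤ g (t - x)}`. -/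
def trawlSet (g : ℝ → ℝ) (t : ℝ) : Set (ℝ × ℝ) :=
  {p | p.1 ≤ t ∧ 0 ≤ p.2 ∧ p.2 ≤ g (t - p.1)}

/-- `X` is a jointly measurable version of the trawl process `t ↦ Λ(A_t)`, `t ≥ 0`. -/
structure IsTrawlProcess {Ω : Type*} [MeasurableSpace Ω] (P : Measure Ω)
    (Λ : Set (ℝ × ℝ) → Ω → ℝ) (g : ℝ → ℝ) (X : ℝ → Ω → ℝ) : Prop where
  measurable : Measurable (fun p : ℝ × Ω => X p.1 p.2)
  ae_eq : ∀ t : ℝ, 0 ≤ t → X t =ᵐ[P] Λ (trawlSet g t)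

/-- The rescaled integrated process `Y_T(t) = (1 / F_T) ∫₀^{Tt} X_s ds`. -/
def rescaledIntegral {Ω : Type*} (F : ℝ → ℝ) (X : ℝ → Ω → ℝ) (T : ℝ) (t : ℝ≥0) (ω : Ω) : ℝ :=
  (1 / F T) * ∫ s in (0 : ℝ)..(T * (t : ℝ)), X s ω

/-- A (standard) symmetric `α`-stable Lévy process: it starts at zero almost surely, has
independent increments, and `ξ_t - ξ_s` has characteristic function `exp(-(t - s)|θ|^α)`
for `s ≤ t` (in particular the increments are stationary and `ξ` is stochastically
continuous). No path regularity is imposed. -/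
structure IsSymmetricStableLevyProcess {Ω : Type*} [MeasurableSpace Ω] (P : Measure Ω) (α : ℝ)
    (ξ : ℝ≥0 → Ω → ℝ) : Prop where
  measurable : ∀ t, Measurable (ξ t)
  zero : ξ 0 =ᵐ[P] 0
  indep : HasIndepIncrements ξ P
  charFun_eq : ∀ s t : ℝ≥0, s ≤ t → ∀ θ : ℝ,
    charFun (P.map (ξ t - ξ s)) θ = ((Real.exp (-(((t : ℝ) - s) * |θ| ^ α)) : ℝ) : ℂ)

/-- Convergence of finite-dimensional distributions, as `T → ∞`. -/
def TendstoFDD {Ω Ω' : Type*} [MeasurableSpace Ω] [MeasurableSpace Ω']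
    (Y : ℝ → ℝ≥0 → Ω → ℝ) (Z : ℝ≥0 → Ω' → ℝ)
    (P : Measure Ω) [IsProbabilityMeasure P] (P' : Measure Ω') [IsProbabilityMeasure P'] : Prop :=
  ∀ (n : ℕ) (t : Fin n → ℝ≥0),
    TendstoInDistribution (fun (T : ℝ) (ω : Ω) (i : Fin n) => Y T (t i) ω) atTop
      (fun (ω : Ω') (i : Fin n) => Z (t i) ω) (fun _ => P) P'

end Trawl

end

/-! By the Cramér–Wold principle it suffices to treat `∑ θ_j Y_T(t_j)`, which is `∫ F_T⁻¹ w(s/T) X_s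
ds` for the step function `w = ∑ θ_j 1_{(0,t_j]}`. A stochastic Fubini theorem
(`IsTrawlProcess.integral_exp_setIntegral`), proved by Riemann sums, first-moment bounds and the
joint characteristic function of `Λ`, gives its characteristic function as `exp(-I_T)` with `I_T = ∫
|∫ F_T⁻¹ w(s/T) 1_{A_s}(p) ds|^α dp`. The problem becomes deterministic.

A point `(x, g(u))` lies in `A_s` exactly for `s ∈ [x, x+u]`, so `u` is its lifetime. Substituting
`y = g(u)` and rescaling by `T` turns `I_T` into `∫ |g'(u)| u^{1+γ} / log T · R(u/T) du`, where
`R(v)` is the `α`-th power integral of the averages of `w` over windows of length `v`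
(`IsWeight.lintegral_trawl`). Since `|g'(u)| u^{2+γ} → C_g`, the weight is asymptotically `C_g du /
(u log T)`, which is `C_g dr` on the logarithmic scale `u = T^r`. For `0 < r < 1` the window `u/T`
shrinks and `R → ∫ |w|^α` by Lebesgue differentiation; for `r > 1` it grows and `R` vanishes like
`v^{-γ}`. Hence `I_T → C_g ∫ |w|^α` (`AssumptionG.tendsto_log_average`,
`IsWeight.tendsto_integral_trawl`).

This limit is the exponent of `∑ θ_j K ξ_{t_j}` with `K = C_g^{1/α}`, computed from independent
increments. The logarithm in `F_T` reflects that all scales between `1` and `T` contribute equally.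
-/

noncomputable section

namespace Trawl

/-! ### Finite additivity and joint characteristic functions of a Lévy basis. -/

section

variable {Ω : Type*} [MeasurableSpace Ω] {P : Measure Ω} {ν : Measure ℝ}
  {Λ : Set (ℝ × ℝ) → Ω → ℝ} {α : ℝ}

namespace IsLevyBasis

lemma empty_ae_eq (hΛ : IsLevyBasis P ν Λ) : Λ ∅ =ᵐ[P] 0 := by
  have h := hΛ.additive (fun _ => ∅) (fun _ => .empty) (by simp) (fun i j _ => by simp) (by simp)
  filter_upwards [h] with ω hω
  simp only [Set.iUnion_empty, Finset.sum_const, Finset.card_range, nsmul_eq_mul] at hω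
  -- The partial sums are `N * Λ ∅ ω`; their convergence forces the constant increment `Λ ∅ ω` to be
  -- zero.
  have h2 := ((tendsto_add_atTop_iff_nat 1).2 hω).sub hω
  simp only [Nat.cast_add, Nat.cast_one, add_mul, one_mul, add_sub_cancel_left, sub_self] at h2
  exact tendsto_nhds_unique tendsto_const_nhds h2

variable {V : Type*} [Encodable V] {B : V → Set (ℝ × ℝ)}

/-- The sequence of sets obtained from a family by means of an encoding of the index type. -/
def decodeSets (B : V → Set (ℝ × ℝ)) (n : ℕ) : Set (ℝ × ℝ) := ⋃ v ∈ Encodable.decode₂ V n, B v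

lemma decodeSets_encode (v : V) : decodeSets B (Encodable.encode v) = B v := by
  simp [decodeSets, Encodable.decode₂_encode]

lemma decodeSets_of_notMem {n : ℕ} (hn : n ∉ Set.range (Encodable.encode : V → ℕ)) :
    decodeSets B n = ∅ := by
  simp only [decodeSets, Set.iUnion_eq_empty]
  intro v hv
  exact absurd ⟨v, Encodable.mem_decode₂.1 hv⟩ hn

lemma measurableSet_decodeSets (hB : ∀ v, MeasurableSet (B v)) (n : ℕ) :
    MeasurableSet (decodeSets B n) :=
  Encodable.iUnion_decode₂_cases (C := MeasurableSet) .empty hB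

lemma volume_decodeSets (hB : ∀ v, volume (B v) < ⊤) (n : ℕ) : volume (decodeSets B n) < ⊤ :=
  Encodable.iUnion_decode₂_cases (C := fun s => volume s < ⊤) (by simp) hB

/-- The values on a countable family of disjoint sets are independent. -/
lemma indep_countable (hΛ : IsLevyBasis P ν Λ) (hB : ∀ v, MeasurableSet (B v))
    (hB' : ∀ v, volume (B v) < ⊤) (hd : Pairwise (fun i j => Disjoint (B i) (B j))) :
    iIndepFun (fun v => Λ (B v)) P := by
  have h := (hΛ.indep (decodeSets B) (measurableSet_decodeSets hB) (volume_decodeSets hB')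
    (Encodable.iUnion_decode₂_disjoint_on hd)).precomp (Encodable.encode_injective (α := V))
  simpa [decodeSets_encode] using h

/-- Finite additivity. -/
lemma iUnion_ae_eq [Fintype V] (hΛ : IsLevyBasis P ν Λ) (hB : ∀ v, MeasurableSet (B v))
    (hB' : ∀ v, volume (B v) < ⊤) (hd : Pairwise (fun i j => Disjoint (B i) (B j))) :
    ∀ᵐ ω ∂P, Λ (⋃ v, B v) ω = ∑ v, Λ (B v) ω := by
  have hU : ⋃ n, decodeSets B n = ⋃ v, B v := Encodable.iUnion_decode₂ B
  have h := hΛ.additive (decodeSets B) (measurableSet_decodeSets hB) (volume_decodeSets hB')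
    (Encodable.iUnion_decode₂_disjoint_on hd)
    (by rw [hU]; exact (measure_iUnion_fintype_le _ B).trans_lt (ENNReal.sum_lt_top.2 fun v _ => hB' v))
  rw [hU] at h
  filter_upwards [h, hΛ.empty_ae_eq] with ω hω h0
  refine tendsto_nhds_unique hω (tendsto_const_nhds.congr' ?_)
  obtain ⟨N, hN⟩ := (Finset.univ.image (Encodable.encode : V → ℕ)).exists_nat_subset_range
  filter_upwards [eventually_ge_atTop N] with n hn
  rw [← Finset.sum_subset (hN.trans (Finset.range_mono hn)),
    Finset.sum_image (fun a _ b _ hab => Encodable.encode_injective hab)]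
  · simp [decodeSets_encode]
  · intro k _ hk
    rw [decodeSets_of_notMem (by simpa using hk)]
    exact h0

lemma union_ae_eq (hΛ : IsLevyBasis P ν Λ) {A B : Set (ℝ × ℝ)} (hA : MeasurableSet A)
    (hB : MeasurableSet B) (hA' : volume A < ⊤) (hB' : volume B < ⊤) (hd : Disjoint A B) :
    ∀ᵐ ω ∂P, Λ (A ∪ B) ω = Λ A ω + Λ B ω := by
  have h := hΛ.iUnion_ae_eq (B := fun b : Bool => cond b A B)
    (by rintro (_ | _) <;> assumption) (by rintro (_ | _) <;> assumption)
    (by rintro (_ | _) (_ | _) h <;> first | exact absurd rfl h | exact hd | exact hd.symm)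
  rw [← Set.union_eq_iUnion] at h
  simpa using h

/-- The common part cancels, so increments are controlled by the measures of the set differences
alone. -/
lemma sub_ae_eq (hΛ : IsLevyBasis P ν Λ) {A B : Set (ℝ × ℝ)} (hA : MeasurableSet A)
    (hB : MeasurableSet B) (hA' : volume A < ⊤) (hB' : volume B < ⊤) :
    ∀ᵐ ω ∂P, Λ A ω - Λ B ω = Λ (A \ B) ω - Λ (B \ A) ω := by
  have h1 := hΛ.union_ae_eq (hA.inter hB) (hA.diff hB) (measure_mono Set.inter_subset_left |>.trans_lt hA')
    (measure_mono Set.sdiff_subset |>.trans_lt hA') Set.disjoint_sdiff_inter.symm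
  have h2 := hΛ.union_ae_eq (hB.inter hA) (hB.diff hA) (measure_mono Set.inter_subset_left |>.trans_lt hB')
    (measure_mono Set.sdiff_subset |>.trans_lt hB') Set.disjoint_sdiff_inter.symm
  rw [Set.inter_union_sdiff] at h1 h2
  filter_upwards [h1, h2] with ω h1 h2
  rw [h1, h2, Set.inter_comm B A]
  ring

/-- The joint characteristic function of the values on finitely many disjoint sets. -/
lemma integral_exp_sum_disjoint [IsProbabilityMeasure P] [Fintype V] (hΛ : IsLevyBasis P ν Λ)
    (hψ : ∀ θ : ℝ, levyExponent ν θ = |θ| ^ α)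
    (hB : ∀ v, MeasurableSet (B v))
    (hB' : ∀ v, volume (B v) < ⊤) (hd : Pairwise (fun i j => Disjoint (B i) (B j)))
    (d : V → ℝ) :
    ∫ ω, Complex.exp ((∑ v, d v * Λ (B v) ω : ℝ) * Complex.I) ∂P =
      ((Real.exp (-∑ v, (volume (B v)).toReal * |d v| ^ α) : ℝ) : ℂ) := by
  have hm : ∀ v, Measurable (Λ (B v)) := fun v => hΛ.measurable _ (hB v) (hB' v)
  have hi : iIndepFun (fun v => fun ω => d v * Λ (B v) ω) P :=
    (hΛ.indep_countable hB hB' hd).comp (fun v x => d v * x) (fun v => measurable_const_mul (d v))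
  have h := congrFun (hi.charFun_map_fun_sum_eq_prod (fun v => ((hm v).const_mul _).aemeasurable)) 1
  rw [charFun_apply_real, integral_map (by fun_prop) (by fun_prop)] at h
  simp only [Complex.ofReal_one, one_mul] at h
  rw [h, Finset.prod_apply]
  simp_rw [charFun_map_mul_comp (hm _).aemeasurable, hΛ.charFun_eq _ (hB _) (hB' _), hψ]
  rw [← Complex.ofReal_prod, ← Real.exp_sum]
  simp

/-- The joint characteristic function of the values on finitely many sets. -/
lemma integral_exp_sum [IsProbabilityMeasure P] {ι : Type*} [Fintype ι] (hα : α ≠ 0)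
    (hΛ : IsLevyBasis P ν Λ)
    (hψ : ∀ θ : ℝ, levyExponent ν θ = |θ| ^ α) {A : ι → Set (ℝ × ℝ)}
    (hA : ∀ k, MeasurableSet (A k)) (hA' : ∀ k, volume (A k) < ⊤) (c : ι → ℝ) :
    ∫ ω, Complex.exp ((∑ k, c k * Λ (A k) ω : ℝ) * Complex.I) ∂P =
      ((Real.exp (-∫ p, |∑ k, c k * (A k).indicator 1 p| ^ α) : ℝ) : ℂ) := by
  classical
  let U : Set (ℝ × ℝ) := ⋃ k, A k
  -- The atoms of the algebra generated by the `A k`, indexed by the set of `k` to which their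
  -- points belong. Intersecting with `U` makes the atom of `S = ∅` empty; otherwise it would have
  -- infinite measure.
  let B : Finset ι → Set (ℝ × ℝ) := fun S => U ∩ {p | ∀ k, p ∈ A k ↔ k ∈ S}
  have hBm : ∀ S, MeasurableSet (B S) := by
    intro S
    refine (MeasurableSet.iUnion hA).inter ?_
    simp only [Set.ofPred_forall]
    refine MeasurableSet.iInter fun k => ?_
    by_cases hk : k ∈ S
    · simpa [hk] using hA k
    · simpa [hk] using (hA k).compl.mem
  have hUf : volume U < ⊤ :=
    (measure_iUnion_fintype_le _ A).trans_lt (ENNReal.sum_lt_top.2 fun k _ => hA' k)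
  have hBf : ∀ S, volume (B S) < ⊤ := fun S =>
    (measure_mono Set.inter_subset_left).trans_lt hUf
  have hd : Pairwise (fun i j => Disjoint (B i) (B j)) := by
    intro S S' hS
    refine Set.disjoint_left.2 fun p hp hp' => hS ?_
    ext k
    rw [← hp.2 k, hp'.2 k]
  have hAB : ∀ k, A k = ⋃ S, (if k ∈ S then B S else ∅) := by
    intro k
    ext p
    simp only [Set.mem_iUnion]
    constructor
    · intro hp
      refine ⟨Finset.univ.filter (fun k => p ∈ A k), ?_⟩
      rw [if_pos (by simpa using hp)]
      exact ⟨Set.mem_iUnion.2 ⟨k, hp⟩, fun k => by simp⟩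
    · rintro ⟨S, hS⟩
      split_ifs at hS with hk
      · exact (hS.2 k).2 hk
      · exact hS.elim
  let _ : Encodable (Finset ι) := Fintype.toEncodable _
  have hΛA : ∀ k, ∀ᵐ ω ∂P, Λ (A k) ω = ∑ S, (if k ∈ S then Λ (B S) ω else 0) := by
    intro k
    have h := hΛ.iUnion_ae_eq (B := fun S => if k ∈ S then B S else ∅)
      (fun S => by split_ifs <;> simp [hBm]) (fun S => by split_ifs <;> simp [hBf])
      (fun S S' hS => by
        show Disjoint _ _
        split_ifs
        · exact hd hS
        all_goals simp)
    rw [← hAB k] at h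
    filter_upwards [h, hΛ.empty_ae_eq] with ω hω h0
    rw [hω]
    refine Finset.sum_congr rfl fun S _ => ?_
    split_ifs
    · rfl
    · exact h0
  have hsum : ∀ᵐ ω ∂P, ∑ k, c k * Λ (A k) ω = ∑ S : Finset ι, (∑ k ∈ S, c k) * Λ (B S) ω := by
    filter_upwards [ae_all_iff.2 hΛA] with ω hω
    simp_rw [hω, Finset.mul_sum]
    rw [Finset.sum_comm]
    refine Finset.sum_congr rfl fun S _ => ?_
    rw [Finset.sum_mul, ← Finset.sum_filter_add_sum_filter_not Finset.univ (fun k => k ∈ S)]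
    simp only [Finset.filter_univ_mem]
    rw [Finset.sum_congr rfl fun k hk => by rw [if_pos hk],
      Finset.sum_eq_zero (s := Finset.univ.filter (fun k => k ∉ S))
        fun k hk => by rw [if_neg (by simpa using hk), mul_zero], add_zero]
  have hpt : ∀ p, |∑ k, c k * (A k).indicator (1 : ℝ × ℝ → ℝ) p| ^ α =
      ∑ S : Finset ι, (B S).indicator (fun _ => |∑ k ∈ S, c k| ^ α) p := by
    intro p
    by_cases hp : p ∈ U
    · set S₀ : Finset ι := Finset.univ.filter (fun k => p ∈ A k)
      have hpS : p ∈ B S₀ := ⟨hp, fun k => by simp [S₀]⟩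
      rw [Finset.sum_eq_single S₀, Set.indicator_of_mem hpS]
      · simp [S₀, Finset.sum_filter, Set.indicator_apply]
      · intro S _ hS
        rw [Set.indicator_of_notMem]
        exact fun h => Set.disjoint_left.1 (hd hS) h hpS
      · simp
    · have h1 : ∀ k, p ∉ A k := fun k hk => hp (Set.mem_iUnion.2 ⟨k, hk⟩)
      have h2 : ∀ S, p ∉ B S := fun S h => hp h.1
      simp [h1, h2, Real.zero_rpow hα]
  rw [integral_congr_ae (g := fun ω => Complex.exp
    ((∑ S : Finset ι, (∑ k ∈ S, c k) * Λ (B S) ω : ℝ) * Complex.I))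
    (by filter_upwards [hsum] with ω hω; rw [hω]),
    hΛ.integral_exp_sum_disjoint hψ hBm hBf hd]
  simp_rw [hpt]
  rw [integral_finsetSum]
  · simp_rw [integral_indicator_const _ (hBm _), smul_eq_mul, Measure.real]
  · intro S _
    exact (integrable_indicator_iff (hBm S)).2 (integrableOn_const (hBf S).ne)

end IsLevyBasis

end

/-! ### First moments of a symmetric stable random measure. -/

section

variable {Ω : Type*} [MeasurableSpace Ω] {P : Measure Ω} {ν : Measure ℝ}
  {Λ : Set (ℝ × ℝ) → Ω → ℝ} {α : ℝ}

/-- By scaling, the right side is a constant multiple of `|z|`. Only a lower bound is needed, and `1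
- cos x ≥ (2/π²) x²` on the range `θ ≤ 1/|z|` provides it. This turns first moments into integrals
of characteristic functions. -/
lemma enorm_le_lintegral_one_sub_cos (z : ℝ) :
    ENNReal.ofReal (2 / Real.pi ^ 2) * ‖z‖ₑ ≤
      ∫⁻ θ in Set.Ioi (0 : ℝ), ENNReal.ofReal ((1 - Real.cos (θ * z)) / θ ^ 2) := by
  rcases eq_or_ne z 0 with rfl | hz
  · simp
  have hz' : 0 < |z| := abs_pos.2 hz
  calc ENNReal.ofReal (2 / Real.pi ^ 2) * ‖z‖ₑ
      = ∫⁻ _ in Set.Ioc (0 : ℝ) (1 / |z|), ENNReal.ofReal (2 / Real.pi ^ 2 * z ^ 2) := by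
        rw [setLIntegral_const, Real.volume_Ioc, sub_zero, Real.enorm_eq_ofReal_abs,
          ← ENNReal.ofReal_mul (by positivity), ← ENNReal.ofReal_mul (by positivity), ← sq_abs z]
        congr 1
        field_simp
    _ ≤ ∫⁻ θ in Set.Ioc (0 : ℝ) (1 / |z|), ENNReal.ofReal ((1 - Real.cos (θ * z)) / θ ^ 2) := by
        refine setLIntegral_mono' measurableSet_Ioc fun θ hθ => ENNReal.ofReal_le_ofReal ?_
        have h1 : |θ * z| ≤ 1 := by
          rw [abs_mul, abs_of_pos hθ.1]
          exact (le_div_iff₀ hz').1 hθ.2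
        have h2 := Real.cos_le_one_sub_mul_cos_sq (x := θ * z)
        have h3 := h2
          (h1.trans (by linarith [Real.pi_gt_three]))
        rw [le_div_iff₀ (pow_pos hθ.1 2)]
        nlinarith
    _ ≤ _ := lintegral_mono_set Set.Ioc_subset_Ioi_self

lemma lintegral_one_sub_exp_le (hα : 1 < α) {a v : ℝ} (hav : a ≤ v) (hv : 0 < v) :
    ∫⁻ θ in Set.Ioi (0 : ℝ), ENNReal.ofReal ((1 - Real.exp (-(a * |θ| ^ α))) / θ ^ 2) ≤
      ENNReal.ofReal ((1 / (α - 1) + 1) * v ^ (1 / α)) := by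
  -- The threshold at which `v θ^α` equals one: below it `1 - e^{-x} ≤ x` is used (integrable at
  -- zero because `α > 1`), above it the bound `1`.
  set R : ℝ := v ^ (-(1 / α))
  have hR : 0 < R := Real.rpow_pos_of_pos hv _
  rw [← Set.Ioc_union_Ioi_eq_Ioi hR.le, add_mul, ENNReal.ofReal_add
    (by have := sub_pos.2 hα; positivity) (by positivity)]
  refine (lintegral_union_le _ _ _).trans (add_le_add ?_ ?_)
  · have hexp : (1 : ℝ) + -(1 / α) * (α - 2 + 1) = 1 / α := by field_simp; ring
    have hint : IntegrableOn (fun θ : ℝ => v * θ ^ (α - 2)) (Set.Ioc 0 R) := by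
      have := (intervalIntegral.intervalIntegrable_rpow' (a := 0) (b := R) (r := α - 2)
        (by linarith)).const_mul v
      exact (intervalIntegrable_iff_integrableOn_Ioc_of_le hR.le).1 this
    calc _ ≤ ∫⁻ θ in Set.Ioc (0 : ℝ) R, ENNReal.ofReal (v * θ ^ (α - 2)) := by
          refine setLIntegral_mono' measurableSet_Ioc fun θ hθ => ENNReal.ofReal_le_ofReal ?_
          have h0 : (0 : ℝ) < θ := hθ.1
          rw [abs_of_pos h0, Real.rpow_sub h0, div_le_iff₀ (pow_pos h0 2), Real.rpow_two, mul_assoc,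
            div_mul_cancel₀ _ (by positivity)]
          have := Real.one_sub_le_exp_neg (a * θ ^ α)
          have : a * θ ^ α ≤ v * θ ^ α := by gcongr
          linarith
      _ = ENNReal.ofReal (∫ θ in Set.Ioc (0 : ℝ) R, v * θ ^ (α - 2)) := by
          rw [ofReal_integral_eq_lintegral_ofReal hint]
          refine (ae_restrict_iff' measurableSet_Ioc).2 (ae_of_all _ fun θ hθ => ?_)
          have h0 : (0 : ℝ) < θ := hθ.1
          show 0 ≤ _
          positivity
      _ = _ := by
          rw [← intervalIntegral.integral_of_le hR.le, intervalIntegral.integral_const_mul,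
            integral_rpow (Or.inl (by linarith)), Real.zero_rpow (by linarith), sub_zero,
            ← Real.rpow_mul hv.le, mul_div_assoc', ← Real.rpow_one_add' hv.le]
          · rw [one_div_mul_eq_div, hexp, show α - 2 + 1 = α - 1 by ring]
          · rw [hexp]; positivity
  · have hint := integrableOn_Ioi_rpow_of_lt (a := -2) (by norm_num) hR
    calc _ ≤ ∫⁻ θ in Set.Ioi R, ENNReal.ofReal (θ ^ (-2 : ℝ)) := by
          refine setLIntegral_mono' measurableSet_Ioi fun θ hθ => ENNReal.ofReal_le_ofReal ?_
          have h0 : (0 : ℝ) < θ := hR.trans hθ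
          rw [Real.rpow_neg h0.le, Real.rpow_two, div_eq_mul_inv]
          have := Real.exp_pos (-(a * |θ| ^ α))
          have h3 : (0 : ℝ) ≤ (θ ^ 2)⁻¹ := by positivity
          nlinarith
      _ = ENNReal.ofReal (∫ θ in Set.Ioi R, θ ^ (-2 : ℝ)) := by
          rw [ofReal_integral_eq_lintegral_ofReal hint]
          refine (ae_restrict_iff' measurableSet_Ioi).2 (ae_of_all _ fun θ hθ => ?_)
          have h0 : (0 : ℝ) < θ := hR.trans hθ
          show 0 ≤ _
          positivity
      _ = _ := by
          rw [integral_Ioi_rpow_of_lt (by norm_num) hR, one_mul]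
          norm_num
          rw [← Real.rpow_mul hv.le]
          norm_num

namespace IsLevyBasis

/-- A first moment bound for a symmetric stable random measure. -/
lemma lintegral_enorm_le [IsProbabilityMeasure P] (hα : 1 < α) (hΛ : IsLevyBasis P ν Λ)
    (hψ : ∀ θ : ℝ, levyExponent ν θ = |θ| ^ α) {A : Set (ℝ × ℝ)} (hA : MeasurableSet A) {v : ℝ}
    (hv : 0 < v) (hAv : volume A ≤ ENNReal.ofReal v) :
    ∫⁻ ω, ‖Λ A ω‖ₑ ∂P ≤
      ENNReal.ofReal (Real.pi ^ 2 / 2 * (1 / (α - 1) + 1) * v ^ (1 / α)) := by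
  have hAf : volume A < ⊤ := hAv.trans_lt ENNReal.ofReal_lt_top
  have hm : Measurable (Λ A) := hΛ.measurable A hA hAf
  have hcos : ∀ θ : ℝ, ∫ ω, Real.cos (θ * Λ A ω) ∂P =
      Real.exp (-((volume A).toReal * |θ| ^ α)) := by
    intro θ
    have h := hΛ.charFun_eq A hA hAf θ
    rw [charFun_apply_real, integral_map (by fun_prop) (by fun_prop), hψ] at h
    have hi : Integrable (fun ω => Complex.exp (θ * Λ A ω * Complex.I)) P := by
      refine Integrable.of_bound (by fun_prop) 1 (ae_of_all _ fun ω => ?_)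
      rw [← Complex.ofReal_mul, Complex.norm_exp_ofReal_mul_I]
    have h2 := congrArg Complex.re h
    have h3 := integral_re hi
    simp only [RCLike.re_to_complex] at h3
    rw [← h3, Complex.ofReal_re] at h2
    rw [← h2]
    refine integral_congr_ae (ae_of_all _ fun ω => ?_)
    show Real.cos (θ * Λ A ω) = (Complex.exp (θ * Λ A ω * Complex.I)).re
    rw [← Complex.ofReal_mul, Complex.exp_ofReal_mul_I_re]
  -- Tonelli exchanges the integrals over `ω` and `θ`; the inner expectation is then one minus the
  -- characteristic function.
  have hfub : ∫⁻ ω, ENNReal.ofReal (2 / Real.pi ^ 2) * ‖Λ A ω‖ₑ ∂P ≤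
      ENNReal.ofReal ((1 / (α - 1) + 1) * v ^ (1 / α)) := by
    calc _ ≤ ∫⁻ ω, (∫⁻ θ in Set.Ioi (0 : ℝ),
            ENNReal.ofReal ((1 - Real.cos (θ * Λ A ω)) / θ ^ 2)) ∂P :=
          lintegral_mono fun ω => enorm_le_lintegral_one_sub_cos _
      _ = ∫⁻ θ in Set.Ioi (0 : ℝ), ∫⁻ ω,
            ENNReal.ofReal ((1 - Real.cos (θ * Λ A ω)) / θ ^ 2) ∂P := by
          rw [lintegral_lintegral_swap]
          fun_prop
      _ = ∫⁻ θ in Set.Ioi (0 : ℝ),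
            ENNReal.ofReal ((1 - Real.exp (-((volume A).toReal * |θ| ^ α))) / θ ^ 2) := by
          refine lintegral_congr fun θ => ?_
          have hi : Integrable (fun ω => Real.cos (θ * Λ A ω)) P :=
            Integrable.of_bound (by fun_prop) 1 (ae_of_all _ fun ω => Real.abs_cos_le_one _)
          rw [← ofReal_integral_eq_lintegral_ofReal, integral_div,
            integral_sub (integrable_const _) hi, hcos]
          · simp
          · exact ((integrable_const _).sub hi).div_const _
          · refine ae_of_all _ fun ω => ?_
            have := Real.cos_le_one (θ * Λ A ω)
            show 0 ≤ _
            exact div_nonneg (by linarith) (by positivity)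
      _ ≤ _ := lintegral_one_sub_exp_le hα
          (ENNReal.toReal_le_of_le_ofReal hv.le hAv) hv
  rw [lintegral_const_mul _ (by fun_prop)] at hfub
  have hpi : ENNReal.ofReal (Real.pi ^ 2 / 2) * ENNReal.ofReal (2 / Real.pi ^ 2) = 1 := by
    rw [← ENNReal.ofReal_mul (by positivity)]
    simp [field]
  calc ∫⁻ ω, ‖Λ A ω‖ₑ ∂P
      = ENNReal.ofReal (Real.pi ^ 2 / 2) *
        (ENNReal.ofReal (2 / Real.pi ^ 2) * ∫⁻ ω, ‖Λ A ω‖ₑ ∂P) := by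
        rw [← mul_assoc, hpi, one_mul]
    _ ≤ _ := by
        refine (mul_le_mul_right hfub _).trans ?_
        rw [← ENNReal.ofReal_mul (by positivity), mul_assoc]

lemma lintegral_enorm_sub_le [IsProbabilityMeasure P] (hα : 1 < α) (hΛ : IsLevyBasis P ν Λ)
    (hψ : ∀ θ : ℝ, levyExponent ν θ = |θ| ^ α) {A B : Set (ℝ × ℝ)} (hA : MeasurableSet A)
    (hB : MeasurableSet B) (hA' : volume A < ⊤) (hB' : volume B < ⊤) {v : ℝ}
    (hv : 0 < v) (hAB : volume (A \ B) ≤ ENNReal.ofReal v)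
    (hBA : volume (B \ A) ≤ ENNReal.ofReal v) :
    ∫⁻ ω, ‖Λ A ω - Λ B ω‖ₑ ∂P ≤
      ENNReal.ofReal (Real.pi ^ 2 * (1 / (α - 1) + 1) * v ^ (1 / α)) := by
  have h1 := hΛ.lintegral_enorm_le hα hψ (hA.diff hB) hv hAB
  have h2 := hΛ.lintegral_enorm_le hα hψ (hB.diff hA) hv hBA
  calc _ ≤ ∫⁻ ω, (‖Λ (A \ B) ω‖ₑ + ‖Λ (B \ A) ω‖ₑ) ∂P := by
        refine lintegral_mono_ae ?_
        filter_upwards [hΛ.sub_ae_eq hA hB hA' hB'] with ω hω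
        rw [hω]
        exact enorm_sub_le
    _ ≤ _ := by
        rw [lintegral_add_left
          (hΛ.measurable _ (hA.diff hB) (hAB.trans_lt ENNReal.ofReal_lt_top)).enorm]
        refine (add_le_add h1 h2).trans ?_
        have := sub_pos.2 hα
        rw [← ENNReal.ofReal_add (by positivity) (by positivity)]
        exact ENNReal.ofReal_le_ofReal (by linarith)

end IsLevyBasis

end

/-! ### Geometry of the trawl sets, and existence of a stable Lévy process. -/

section

variable {Ω : Type*} [MeasurableSpace Ω] {P : Measure Ω} {ν : Measure ℝ}
  {Λ : Set (ℝ × ℝ) → Ω → ℝ} {α : ℝ} {g : ℝ → ℝ} {γ Cg : ℝ}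

namespace AssumptionG

/-- Nothing is known about `g` on the negative half-line, not even measurability; truncating the
argument removes those values. -/
lemma continuous_comp_max (hg : AssumptionG g γ Cg) : Continuous fun x : ℝ => g (max x 0) :=
  hg.continuousOn.comp_continuous (by fun_prop) fun _ => Set.mem_Ici.2 (le_max_right _ _)

lemma trawlSet_eq (t : ℝ) :
    trawlSet g t = {p | p.1 ≤ t ∧ 0 ≤ p.2 ∧ p.2 ≤ g (max (t - p.1) 0)} := by
  ext p
  simp only [trawlSet, Set.mem_ofPred_eq]
  refine and_congr_right fun h => ?_
  rw [max_eq_left (sub_nonneg.2 h)]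

lemma measurableSet_trawl_prod (hg : AssumptionG g γ Cg) :
    MeasurableSet {q : ℝ × ℝ × ℝ | q.2 ∈ trawlSet g q.1} := by
  simp_rw [trawlSet_eq]
  have := hg.continuous_comp_max
  have h : Measurable fun q : ℝ × ℝ × ℝ => g (max (q.1 - q.2.1) 0) :=
    this.measurable.comp (g := fun x : ℝ => g (max x 0)) (f := fun q : ℝ × ℝ × ℝ => q.1 - q.2.1)
      (by fun_prop)
  exact (measurableSet_le (f := fun q : ℝ × ℝ × ℝ => q.2.1) (by fun_prop) measurable_fst).inter
    ((measurableSet_le (f := fun _ : ℝ × ℝ × ℝ => (0 : ℝ)) (g := fun q => q.2.2)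
      (by fun_prop) (by fun_prop)).inter
      (measurableSet_le (f := fun q : ℝ × ℝ × ℝ => q.2.2) (by fun_prop) h))

lemma measurableSet_trawlSet (hg : AssumptionG g γ Cg) (t : ℝ) : MeasurableSet (trawlSet g t) :=
  measurable_prodMk_left (x := t) hg.measurableSet_trawl_prod

lemma volume_trawlSet_eq (hg : AssumptionG g γ Cg) (t : ℝ) :
    volume (trawlSet g t) = ∫⁻ x in Set.Ici 0, ENNReal.ofReal (g x) := by
  rw [Measure.volume_eq_prod, Measure.prod_apply (hg.measurableSet_trawlSet t),
    ← lintegral_indicator measurableSet_Ici, ← lintegral_sub_left_eq_self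
      (Set.indicator (Set.Ici 0) fun x => ENNReal.ofReal (g x)) t]
  refine lintegral_congr fun x => ?_
  by_cases hx : x ≤ t
  · rw [Set.indicator_of_mem (by simpa using hx)]
    have : Prod.mk x ⁻¹' trawlSet g t = Set.Icc 0 (g (t - x)) := by
      ext y; simp [trawlSet, hx]
    rw [this, Real.volume_Icc, sub_zero]
  · rw [Set.indicator_of_notMem (by simpa using hx)]
    have : Prod.mk x ⁻¹' trawlSet g t = ∅ := by
      ext y; simp [trawlSet, hx]
    rw [this, measure_empty]

lemma volume_trawlSet_lt_top (hg : AssumptionG g γ Cg) (t : ℝ) : volume (trawlSet g t) < ⊤ := by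
  rw [hg.volume_trawlSet_eq]
  exact hg.integrableOn.lintegral_lt_top

lemma le_zero (hg : AssumptionG g γ Cg) {x : ℝ} (hx : 0 ≤ x) : g x ≤ g 0 :=
  hg.strictAntiOn.antitoneOn (Set.mem_Ici.2 le_rfl) (Set.mem_Ici.2 hx) hx

lemma zero_pos (hg : AssumptionG g γ Cg) : 0 < g 0 :=
  (hg.nonneg 1 zero_le_one).trans_lt
    (hg.strictAntiOn (Set.mem_Ici.2 le_rfl) (Set.mem_Ici.2 zero_le_one) one_pos)

lemma trawlSet_subset_union (hg : AssumptionG g γ Cg) {s t : ℝ} (hst : s ≤ t) :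
    trawlSet g t ⊆ trawlSet g s ∪ Set.Ioc s t ×ˢ Set.Icc 0 (g 0) := by
  rintro ⟨x, y⟩ ⟨h1, h2, h3⟩
  simp only at h1 h2 h3
  rcases le_or_gt x s with hx | hx
  · refine Or.inl ⟨hx, h2, h3.trans ?_⟩
    exact hg.strictAntiOn.antitoneOn (Set.mem_Ici.2 (by simpa using hx))
      (Set.mem_Ici.2 (by simpa using h1)) (by simp only; linarith)
  · exact Or.inr ⟨⟨hx, h1⟩, h2, h3.trans (hg.le_zero (by linarith))⟩

lemma volume_trawlSet_sdiff_le (hg : AssumptionG g γ Cg) {s t : ℝ} (hst : s ≤ t) :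
    volume (trawlSet g t \ trawlSet g s) ≤ ENNReal.ofReal ((t - s) * g 0) := by
  calc _ ≤ volume (Set.Ioc s t ×ˢ Set.Icc 0 (g 0)) :=
        measure_mono (Set.sdiff_subset_iff.2 (hg.trawlSet_subset_union hst))
    _ = _ := by
        rw [Measure.volume_eq_prod, Measure.prod_prod, Real.volume_Ioc, Real.volume_Icc, sub_zero,
          ENNReal.ofReal_mul (by linarith)]

/-- All trawl sets have the same finite volume, so the two differences have equal measure. -/
lemma volume_trawlSet_sdiff_le' (hg : AssumptionG g γ Cg) {s t : ℝ} (hst : s ≤ t) :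
    volume (trawlSet g s \ trawlSet g t) ≤ ENNReal.ofReal ((t - s) * g 0) := by
  rw [measure_sdiff_symm (hg.measurableSet_trawlSet s).nullMeasurableSet
    (hg.measurableSet_trawlSet t).nullMeasurableSet]
  · exact hg.volume_trawlSet_sdiff_le hst
  · rw [hg.volume_trawlSet_eq, hg.volume_trawlSet_eq]
  · exact (measure_mono Set.inter_subset_left |>.trans_lt (hg.volume_trawlSet_lt_top s)).ne

/-- A set of finite measure that contains all trawl sets `A_s` with `0 ≤ s ≤ M`. -/
lemma exists_trawlSet_subset (hg : AssumptionG g γ Cg) (M : ℝ) :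
    ∃ U : Set (ℝ × ℝ), MeasurableSet U ∧ volume U < ⊤ ∧
      ∀ s, 0 ≤ s → s ≤ M → trawlSet g s ⊆ U := by
  refine ⟨trawlSet g 0 ∪ Set.Ioc 0 M ×ˢ Set.Icc 0 (g 0),
    (hg.measurableSet_trawlSet 0).union (measurableSet_Ioc.prod measurableSet_Icc),
    measure_union_lt_top (hg.volume_trawlSet_lt_top 0) ?_, fun s hs hsM => ?_⟩
  · rw [Measure.volume_eq_prod, Measure.prod_prod, Real.volume_Ioc, Real.volume_Icc]
    exact ENNReal.mul_lt_top ENNReal.ofReal_lt_top ENNReal.ofReal_lt_top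
  · refine (hg.trawlSet_subset_union hs).trans ?_
    gcongr

end AssumptionG

/-- The values on the rectangles `(0, t] × (0, 1]` form a symmetric stable Lévy process. -/
lemma IsLevyBasis.exists_stableLevyProcess [IsProbabilityMeasure P] (hΛ : IsLevyBasis P ν Λ)
    (hψ : ∀ θ : ℝ, levyExponent ν θ = |θ| ^ α) :
    ∃ ξ : ℝ≥0 → Ω → ℝ, IsSymmetricStableLevyProcess P α ξ := by
  let B : ℝ≥0 → ℝ≥0 → Set (ℝ × ℝ) := fun s t => Set.Ioc (s : ℝ) t ×ˢ Set.Ioc (0 : ℝ) 1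
  have hBm : ∀ s t, MeasurableSet (B s t) := fun s t => measurableSet_Ioc.prod measurableSet_Ioc
  have hBv : ∀ s t, volume (B s t) = ENNReal.ofReal (t - s) := fun s t => by
    simp [B, Measure.volume_eq_prod, Measure.prod_prod]
  have hBf : ∀ s t, volume (B s t) < ⊤ := fun s t => by
    rw [hBv]; exact ENNReal.ofReal_lt_top
  have hinc : ∀ s t, s ≤ t → (fun ω => Λ (B 0 t) ω - Λ (B 0 s) ω) =ᵐ[P] Λ (B s t) := by
    intro s t hst
    have h := hΛ.union_ae_eq (hBm 0 s) (hBm s t) (hBf 0 s) (hBf s t)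
      (Set.disjoint_prod.2 (Or.inl (Set.Ioc_disjoint_Ioc_of_le le_rfl)))
    rw [← Set.union_prod, Set.Ioc_union_Ioc_eq_Ioc (by simp) (by exact_mod_cast hst)] at h
    filter_upwards [h] with ω hω
    show Λ (Set.Ioc ((0 : ℝ≥0) : ℝ) (t : ℝ) ×ˢ Set.Ioc (0 : ℝ) 1) ω - _ = _
    rw [hω]
    ring
  refine ⟨fun t => Λ (B 0 t), fun t => hΛ.measurable _ (hBm 0 t) (hBf 0 t), ?_, ?_, ?_⟩
  · have : B 0 0 = ∅ := by simp [B]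
    simp only [this]
    exact hΛ.empty_ae_eq
  · rw [hasIndepIncrements_iff_nat]
    intro t ht
    have hd : Pairwise (fun i j => Disjoint (B (t i) (t (i + 1))) (B (t j) (t (j + 1)))) := by
      have hlt : ∀ i j, i < j → Disjoint (B (t i) (t (i + 1))) (B (t j) (t (j + 1))) :=
        fun i j hij => Set.disjoint_prod.2 (Or.inl (Set.Ioc_disjoint_Ioc_of_le
          (by exact_mod_cast ht (Nat.succ_le_of_lt hij))))
      intro i j hij
      exact hij.lt_or_gt.elim (hlt i j) fun h => (hlt j i h).symm
    have h := hΛ.indep _ (fun n => hBm (t n) (t (n + 1))) (fun n => hBf _ _) hd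
    exact h.congr fun i => (hinc _ _ (ht (Nat.le_succ i))).symm
  · intro s t hst θ
    rw [Measure.map_congr (show Λ (B 0 t) - Λ (B 0 s) =ᵐ[P] Λ (B s t) from hinc s t hst),
      hΛ.charFun_eq _ (hBm s t) (hBf s t), hψ, hBv, ENNReal.toReal_ofReal (by simpa using hst)]

end

/-! ### Riemann sums and the stochastic Fubini theorem. -/

section

variable {Ω : Type*} [MeasurableSpace Ω] {P : Measure Ω} {ν : Measure ℝ}
  {Λ : Set (ℝ × ℝ) → Ω → ℝ} {α : ℝ} {g : ℝ → ℝ} {γ Cg : ℝ} {X : ℝ → Ω → ℝ}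

/-- Rounding down to the grid of mesh `1 / (n + 1)`. -/
def gridFloor (n : ℕ) (s : ℝ) : ℝ := (⌊s * (n + 1)⌋₊ : ℝ) / (n + 1)

lemma measurable_gridFloor (n : ℕ) : Measurable (gridFloor n) := by
  unfold gridFloor
  have : Measurable fun s : ℝ => ⌊s * (n + 1)⌋₊ := Nat.measurable_floor.comp (by fun_prop)
  exact (measurable_from_top.comp this).div_const _

lemma gridFloor_nonneg (n : ℕ) (s : ℝ) : 0 ≤ gridFloor n s := by
  unfold gridFloor; positivity

lemma gridFloor_le (n : ℕ) {s : ℝ} (hs : 0 ≤ s) : gridFloor n s ≤ s := by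
  unfold gridFloor
  rw [div_le_iff₀ (by positivity)]
  exact Nat.floor_le (by positivity)

lemma sub_gridFloor_le (n : ℕ) (s : ℝ) : s - gridFloor n s ≤ 1 / (n + 1) := by
  unfold gridFloor
  have h : (0 : ℝ) < n + 1 := by positivity
  rw [sub_le_iff_le_add, ← add_div, le_div_iff₀ h]
  linarith [Nat.lt_floor_add_one (s * ((n : ℝ) + 1))]

lemma tendsto_gridFloor {s : ℝ} (hs : 0 ≤ s) :
    Tendsto (fun n => gridFloor n s) atTop (𝓝 s) := by
  have h : Tendsto (fun n : ℕ => s - 1 / ((n : ℝ) + 1)) atTop (𝓝 (s - 0)) :=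
    tendsto_const_nhds.sub tendsto_one_div_add_atTop_nhds_zero_nat
  rw [sub_zero] at h
  exact tendsto_of_tendsto_of_tendsto_of_le_of_le h tendsto_const_nhds
    (fun n => by have := sub_gridFloor_le n s; simp only; linarith) (fun n => gridFloor_le n hs)

/-- The weight that a Riemann sum on the grid of mesh `1 / (n + 1)` gives to the `k`-th point. -/
def gridWeight (w : ℝ → ℝ) (M : ℝ) (n k : ℕ) : ℝ :=
  ∫ s in Set.Ioc 0 M, {s : ℝ | ⌊s * (n + 1)⌋₊ = k}.indicator w s

/-- `F` is arbitrary so that the same finite sum serves for the path `s ↦ X s ω` and for the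
indicator `s ↦ 1_{A_s}(p)`. -/
lemma integral_comp_gridFloor {w : ℝ → ℝ} (hw : Measurable w) {C : ℝ} (hC : ∀ s, |w s| ≤ C)
    (M : ℝ) (n : ℕ) (F : ℝ → ℝ) :
    ∫ s in Set.Ioc 0 M, w s * F (gridFloor n s) =
      ∑ k : Fin (⌊M * (n + 1)⌋₊ + 1), gridWeight w M n k * F ((k : ℕ) / ((n : ℝ) + 1)) := by
  have hS : ∀ k : ℕ, MeasurableSet {s : ℝ | ⌊s * (n + 1)⌋₊ = k} := fun k =>
    (Nat.measurable_floor.comp (by fun_prop : Measurable fun s : ℝ => s * (n + 1)))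
      (measurableSet_singleton k)
  have hwi : IntegrableOn w (Set.Ioc 0 M) :=
    Measure.integrableOn_of_bounded (M := C) (by simp) hw.aestronglyMeasurable
      (ae_of_all _ hC)
  rw [Fin.sum_univ_eq_sum_range
    (fun k => gridWeight w M n k * F ((k : ℕ) / ((n : ℝ) + 1))) (⌊M * (n + 1)⌋₊ + 1)]
  simp_rw [gridWeight, ← integral_mul_const]
  rw [← integral_finsetSum _ fun k _ => (hwi.indicator (hS k)).mul_const _]
  refine setIntegral_congr_fun measurableSet_Ioc fun s hs => ?_
  show w s * F (gridFloor n s) = _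
  have hmem : ⌊s * ((n : ℝ) + 1)⌋₊ ∈ Finset.range (⌊M * ((n : ℝ) + 1)⌋₊ + 1) := by
    rw [Finset.mem_range, Nat.lt_succ_iff]
    exact Nat.floor_mono (by have := hs.2; gcongr)
  rw [Finset.sum_eq_single_of_mem _ hmem]
  · rw [Set.indicator_of_mem (by rfl)]
    rfl
  · intro k _ hk
    rw [Set.indicator_of_notMem (fun h => hk h.symm), zero_mul]

lemma enorm_exp_sub_exp_le (a b : ℝ) :
    ‖Complex.exp (a * Complex.I) - Complex.exp (b * Complex.I)‖ₑ ≤ ‖a - b‖ₑ := by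
  have h : Complex.exp (a * Complex.I) - Complex.exp (b * Complex.I) =
      Complex.exp (b * Complex.I) * (Complex.exp (Complex.I * ((a - b : ℝ) : ℂ)) - 1) := by
    rw [mul_sub, ← Complex.exp_add, mul_one]
    congr 2
    push_cast
    ring
  rw [h, enorm_mul, ← ofReal_norm, Complex.norm_exp_ofReal_mul_I, ENNReal.ofReal_one,
    one_mul, ← ofReal_norm, ← ofReal_norm]
  exact ENNReal.ofReal_le_ofReal Real.norm_exp_I_mul_ofReal_sub_one_le

lemma tendsto_integral_exp [IsProbabilityMeasure P] {Z : ℕ → Ω → ℝ} {Z' : Ω → ℝ}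
    (hZ : ∀ n, AEMeasurable (Z n) P) (hZ' : AEMeasurable Z' P)
    (h : Tendsto (fun n => ∫⁻ ω, ‖Z n ω - Z' ω‖ₑ ∂P) atTop (𝓝 0)) :
    Tendsto (fun n => ∫ ω, Complex.exp (Z n ω * Complex.I) ∂P) atTop
      (𝓝 (∫ ω, Complex.exp (Z' ω * Complex.I) ∂P)) := by
  have hi : ∀ Y : Ω → ℝ, AEMeasurable Y P → Integrable (fun ω => Complex.exp (Y ω * Complex.I)) P :=
    fun Y hY => Integrable.of_bound (by fun_prop) 1
      (ae_of_all _ fun ω => (Complex.norm_exp_ofReal_mul_I _).le)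
  rw [tendsto_iff_edist_tendsto_0]
  refine tendsto_of_tendsto_of_tendsto_of_le_of_le tendsto_const_nhds h (fun _ => zero_le)
    fun n => ?_
  simp only
  rw [edist_eq_enorm_sub, ← integral_sub (hi _ (hZ n)) (hi _ hZ')]
  exact (enorm_integral_le_lintegral_enorm _).trans
    (lintegral_mono fun ω => enorm_exp_sub_exp_le _ _)

namespace IsTrawlProcess

lemma lintegral_enorm_le [IsProbabilityMeasure P] (hX : IsTrawlProcess P Λ g X)
    (hg : AssumptionG g γ Cg) (hα : 1 < α)
    (hΛ : IsLevyBasis P ν Λ) (hψ : ∀ θ : ℝ, levyExponent ν θ = |θ| ^ α) :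
    ∃ C : ℝ≥0, ∀ t, 0 ≤ t → ∫⁻ ω, ‖X t ω‖ₑ ∂P ≤ C := by
  refine ⟨(Real.pi ^ 2 / 2 * (1 / (α - 1) + 1) *
    ((volume (trawlSet g 0)).toReal + 1) ^ (1 / α)).toNNReal, fun t ht => ?_⟩
  · have h := hΛ.lintegral_enorm_le hα hψ (hg.measurableSet_trawlSet t)
      -- Adding one makes `v` positive without a discussion of the volume.
      (v := (volume (trawlSet g 0)).toReal + 1) (by positivity) (by
        rw [hg.volume_trawlSet_eq t, ← hg.volume_trawlSet_eq 0]
        refine (ENNReal.le_ofReal_iff_toReal_le (hg.volume_trawlSet_lt_top 0).ne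
          (by positivity)).2 (by linarith))
    rw [lintegral_congr_ae (g := fun ω => ‖Λ (trawlSet g t) ω‖ₑ)
      (by filter_upwards [hX.ae_eq t ht] with ω hω; rw [hω])]
    exact h

lemma lintegral_enorm_sub_le [IsProbabilityMeasure P] (hX : IsTrawlProcess P Λ g X)
    (hg : AssumptionG g γ Cg) (hα : 1 < α)
    (hΛ : IsLevyBasis P ν Λ) (hψ : ∀ θ : ℝ, levyExponent ν θ = |θ| ^ α) {s t h : ℝ}
    (hs : 0 ≤ s) (hst : s ≤ t) (hh : 0 < h) (hth : t - s ≤ h) :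
    ∫⁻ ω, ‖X s ω - X t ω‖ₑ ∂P ≤
      ENNReal.ofReal (Real.pi ^ 2 * (1 / (α - 1) + 1) * (h * g 0) ^ (1 / α)) := by
  have h0 := hg.zero_pos
  have hle : ENNReal.ofReal ((t - s) * g 0) ≤ ENNReal.ofReal (h * g 0) :=
    ENNReal.ofReal_le_ofReal (by gcongr)
  rw [lintegral_congr_ae (g := fun ω => ‖Λ (trawlSet g s) ω - Λ (trawlSet g t) ω‖ₑ)
    (by filter_upwards [hX.ae_eq s hs, hX.ae_eq t (hs.trans hst)] with ω h1 h2; rw [h1, h2])]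
  exact hΛ.lintegral_enorm_sub_le hα hψ (hg.measurableSet_trawlSet s)
    (hg.measurableSet_trawlSet t) (hg.volume_trawlSet_lt_top s) (hg.volume_trawlSet_lt_top t)
    (mul_pos hh h0) ((hg.volume_trawlSet_sdiff_le' hst).trans hle)
    ((hg.volume_trawlSet_sdiff_le hst).trans hle)

lemma integrable_comp_prod [IsProbabilityMeasure P] (hX : IsTrawlProcess P Λ g X)
    (hg : AssumptionG g γ Cg) (hα : 1 < α)
    (hΛ : IsLevyBasis P ν Λ) (hψ : ∀ θ : ℝ, levyExponent ν θ = |θ| ^ α) (M : ℝ) {τ : ℝ → ℝ}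
    (hτ : Measurable τ) (hτ0 : ∀ s, 0 ≤ s → 0 ≤ τ s) :
    Integrable (fun q : ℝ × Ω => X (τ q.1) q.2) ((volume.restrict (Set.Ioc 0 M)).prod P) := by
  have hm : Measurable (fun q : ℝ × Ω => X (τ q.1) q.2) :=
    hX.measurable.comp ((hτ.comp measurable_fst).prodMk measurable_snd)
  refine ⟨hm.aestronglyMeasurable, ?_⟩
  obtain ⟨C, hC⟩ := hX.lintegral_enorm_le hg hα hΛ hψ
  rw [HasFiniteIntegral, lintegral_prod _ hm.enorm.aemeasurable]
  calc _ ≤ ∫⁻ _ in Set.Ioc 0 M, (C : ℝ≥0∞) :=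
        setLIntegral_mono' measurableSet_Ioc fun s hs => hC _ (hτ0 s hs.1.le)
    _ < ⊤ := by
        rw [setLIntegral_const, Real.volume_Ioc]
        exact ENNReal.mul_lt_top ENNReal.coe_lt_top ENNReal.ofReal_lt_top

lemma ae_integrableOn [IsProbabilityMeasure P] (hX : IsTrawlProcess P Λ g X)
    (hg : AssumptionG g γ Cg) (hα : 1 < α)
    (hΛ : IsLevyBasis P ν Λ) (hψ : ∀ θ : ℝ, levyExponent ν θ = |θ| ^ α) :
    ∀ᵐ ω ∂P, ∀ M : ℝ, IntegrableOn (fun s => X s ω) (Set.Ioc 0 M) := by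
  have h : ∀ N : ℕ, ∀ᵐ ω ∂P, IntegrableOn (fun s => X s ω) (Set.Ioc 0 (N : ℝ)) := fun N =>
    (hX.integrable_comp_prod hg hα hΛ hψ N measurable_id fun _ => id).prod_left_ae
  filter_upwards [ae_all_iff.2 h] with ω hω M
  obtain ⟨N, hN⟩ := exists_nat_ge M
  exact (hω N).mono_set (Set.Ioc_subset_Ioc_right hN)

lemma measurable_setIntegral (hX : IsTrawlProcess P Λ g X) [SFinite P] {w τ : ℝ → ℝ}
    (hw : Measurable w) (hτ : Measurable τ) (S : Set ℝ) :
    Measurable fun ω => ∫ s in S, w s * X (τ s) ω := by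
  have hm : Measurable (fun q : Ω × ℝ => w q.2 * X (τ q.2) q.1) :=
    (hw.comp measurable_snd).mul
      (hX.measurable.comp ((hτ.comp measurable_snd).prodMk measurable_fst))
  exact hm.stronglyMeasurable.integral_prod_right'.measurable

/-- Riemann sums of the trawl process converge in `L¹`. -/
lemma tendsto_lintegral_riemann [IsProbabilityMeasure P] (hX : IsTrawlProcess P Λ g X)
    (hg : AssumptionG g γ Cg) (hα : 1 < α)
    (hΛ : IsLevyBasis P ν Λ) (hψ : ∀ θ : ℝ, levyExponent ν θ = |θ| ^ α) {w : ℝ → ℝ}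
    (hw : Measurable w) {C : ℝ} (hC : ∀ s, |w s| ≤ C) (M : ℝ) :
    Tendsto (fun n => ∫⁻ ω, ‖(∫ s in Set.Ioc 0 M, w s * X (gridFloor n s) ω) -
      ∫ s in Set.Ioc 0 M, w s * X s ω‖ₑ ∂P) atTop (𝓝 0) := by
  have hα0 : 0 < α := by linarith
  have hC0 : 0 ≤ C := (abs_nonneg _).trans (hC 0)
  -- The bound for `E|X_s - X_t|` at distance at most `1/(n+1)`; it does not depend on `s`.
  set B : ℕ → ℝ := fun n =>
    Real.pi ^ 2 * (1 / (α - 1) + 1) * (1 / ((n : ℝ) + 1) * g 0) ^ (1 / α)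
  have hB : Tendsto (fun n => ENNReal.ofReal C * (ENNReal.ofReal (B n) *
      volume (Set.Ioc 0 M))) atTop (𝓝 0) := by
    have h1 : Tendsto B atTop (𝓝 0) := by
      have := ((tendsto_one_div_add_atTop_nhds_zero_nat (𝕜 := ℝ)).mul_const (g 0)).rpow_const
        (p := 1 / α) (Or.inr (by positivity))
      rw [zero_mul, Real.zero_rpow (by positivity)] at this
      simpa [B] using this.const_mul (Real.pi ^ 2 * (1 / (α - 1) + 1))
    have h2 := ENNReal.tendsto_ofReal h1
    rw [ENNReal.ofReal_zero] at h2
    have h3 := ENNReal.Tendsto.mul_const (b := volume (Set.Ioc 0 M)) h2 (Or.inr (by simp))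
    have h4 := ENNReal.Tendsto.const_mul (a := ENNReal.ofReal C) h3 (Or.inr (by simp))
    simpa using h4
  refine tendsto_of_tendsto_of_tendsto_of_le_of_le tendsto_const_nhds hB (fun _ => zero_le)
    fun n => ?_
  have hmeas : ∀ τ : ℝ → ℝ, Measurable τ → Measurable (fun q : Ω × ℝ => X (τ q.2) q.1) :=
    fun τ hτ => hX.measurable.comp ((hτ.comp measurable_snd).prodMk measurable_fst)
  have hm1 := hmeas _ (measurable_gridFloor n)
  have hm2 := hmeas _ measurable_id
  have hi1 := (hX.integrable_comp_prod hg hα hΛ hψ M (measurable_gridFloor n)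
    fun s _ => gridFloor_nonneg n s).prod_left_ae
  have hi2 := (hX.integrable_comp_prod hg hα hΛ hψ M measurable_id fun _ => id).prod_left_ae
  simp only [id] at hm2 hi2
  calc _ ≤ ∫⁻ ω, (ENNReal.ofReal C *
          ∫⁻ s in Set.Ioc 0 M, ‖X (gridFloor n s) ω - X s ω‖ₑ) ∂P := by
        refine lintegral_mono_ae ?_
        filter_upwards [hi1, hi2] with ω h1 h2
        have hb : ∀ᵐ s ∂(volume.restrict (Set.Ioc 0 M)), ‖w s‖ ≤ C := ae_of_all _ hC
        rw [← integral_sub (h1.bdd_mul hw.aestronglyMeasurable hb)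
          (h2.bdd_mul hw.aestronglyMeasurable hb)]
        refine (enorm_integral_le_lintegral_enorm _).trans ?_
        rw [← lintegral_const_mul]
        · refine lintegral_mono fun s => ?_
          rw [← mul_sub, enorm_mul]
          gcongr
          rw [← ofReal_norm]
          exact ENNReal.ofReal_le_ofReal (hC s)
        · exact ((hm1.sub hm2).comp measurable_prodMk_left).enorm
    _ = ENNReal.ofReal C *
          ∫⁻ s in Set.Ioc 0 M, (∫⁻ ω, ‖X (gridFloor n s) ω - X s ω‖ₑ ∂P) := by
        rw [lintegral_const_mul, lintegral_lintegral_swap]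
        · exact (hm1.sub hm2).enorm.aemeasurable
        · exact (hm1.sub hm2).enorm.lintegral_prod_right'
    _ ≤ ENNReal.ofReal C * ∫⁻ _ in Set.Ioc 0 M, ENNReal.ofReal (B n) := by
        gcongr ENNReal.ofReal C * ?_
        refine setLIntegral_mono' measurableSet_Ioc fun s hs => ?_
        exact hX.lintegral_enorm_sub_le hg hα hΛ hψ (gridFloor_nonneg n s)
          (gridFloor_le n hs.1.le) (by positivity) (sub_gridFloor_le n s)
    _ = _ := by rw [setLIntegral_const]

/-- The characteristic functional of the trawl process, as a stochastic Fubini theorem: the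
integral `∫₀ᴹ w(s) X_s ds` has the law of the stable integral of `∫₀ᴹ w(s) 1_{A_s} ds`. -/
lemma integral_exp_setIntegral [IsProbabilityMeasure P] (hX : IsTrawlProcess P Λ g X)
    (hg : AssumptionG g γ Cg) (hα : 1 < α)
    (hΛ : IsLevyBasis P ν Λ) (hψ : ∀ θ : ℝ, levyExponent ν θ = |θ| ^ α) {w : ℝ → ℝ}
    (hw : Measurable w) {C : ℝ} (hC : ∀ s, |w s| ≤ C) {M : ℝ} (hM : 0 ≤ M) :
    ∫ ω, Complex.exp ((∫ s in Set.Ioc 0 M, w s * X s ω : ℝ) * Complex.I) ∂P =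
      ((Real.exp (-∫ p, |∫ s in Set.Ioc 0 M, w s * (trawlSet g s).indicator 1 p| ^ α) : ℝ) : ℂ) := by
  have hα0 : 0 < α := by linarith
  have h1 := tendsto_integral_exp (Z' := fun ω => ∫ s in Set.Ioc 0 M, w s * X s ω)
    (fun n => (hX.measurable_setIntegral (P := P) hw (measurable_gridFloor n)
      (Set.Ioc 0 M)).aemeasurable)
    (hX.measurable_setIntegral (P := P) hw measurable_id (Set.Ioc 0 M)).aemeasurable
    (hX.tendsto_lintegral_riemann hg hα hΛ hψ hw hC M)
  have h2 : ∀ n : ℕ, ∫ ω, Complex.exp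
      ((∫ s in Set.Ioc 0 M, w s * X (gridFloor n s) ω : ℝ) * Complex.I) ∂P =
      ((Real.exp (-∫ p, |∫ s in Set.Ioc 0 M,
        w s * (trawlSet g (gridFloor n s)).indicator 1 p| ^ α) : ℝ) : ℂ) := by
    intro n
    simp_rw [fun ω => integral_comp_gridFloor hw hC M n (fun s => X s ω),
      fun p => integral_comp_gridFloor hw hC M n (fun s => (trawlSet g s).indicator 1 p)]
    have hnn : ∀ k : ℕ, (0 : ℝ) ≤ k / ((n : ℝ) + 1) := fun k => by positivity
    rw [← hΛ.integral_exp_sum hα0.ne' hψ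
      (A := fun k : Fin (⌊M * ((n : ℝ) + 1)⌋₊ + 1) => trawlSet g ((k : ℕ) / ((n : ℝ) + 1)))
      (fun k => hg.measurableSet_trawlSet _) (fun k => hg.volume_trawlSet_lt_top _)]
    refine integral_congr_ae ?_
    have h := ae_all_iff.2 fun k : ℕ => hX.ae_eq _ (hnn k)
    filter_upwards [h] with ω hω
    simp_rw [hω]
  simp_rw [h2] at h1
  -- It remains to pass to the limit in the deterministic exponent, by dominated convergence in `p`
  -- and, inside, in `s`.
  refine tendsto_nhds_unique h1 ?_
  refine (Complex.continuous_ofReal.tendsto _).comp ((Real.continuous_exp.tendsto _).comp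
    (Tendsto.neg ?_))
  obtain ⟨U, hUm, hUf, hU⟩ := hg.exists_trawlSet_subset M
  have hC0 : 0 ≤ C := (abs_nonneg _).trans (hC 0)
  have hmeas : ∀ τ : ℝ → ℝ, Measurable τ → Measurable fun q : (ℝ × ℝ) × ℝ =>
      w q.2 * (trawlSet g (τ q.2)).indicator (1 : ℝ × ℝ → ℝ) q.1 := by
    intro τ hτ
    refine (hw.comp measurable_snd).mul ?_
    exact (measurable_const (a := (1 : ℝ))).indicator
      (((hτ.comp measurable_snd).prodMk measurable_fst) hg.measurableSet_trawl_prod)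
  have hbd : ∀ s t p, |w s * (trawlSet g t).indicator (1 : ℝ × ℝ → ℝ) p| ≤ C := by
    intro s t p
    rw [abs_mul]
    refine (mul_le_of_le_one_right (abs_nonneg _) ?_).trans (hC s)
    by_cases hp : p ∈ trawlSet g t <;> simp [hp]
  refine tendsto_integral_of_dominated_convergence (U.indicator fun _ => (C * M) ^ α) ?_ ?_ ?_ ?_
  · intro n
    have := (hmeas _ (measurable_gridFloor n)).stronglyMeasurable.integral_prod_right'
      (ν := volume.restrict (Set.Ioc 0 M))
    exact (this.measurable.abs.pow_const α).aestronglyMeasurable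
  · exact (integrable_indicator_iff hUm).2 (integrableOn_const hUf.ne)
  · intro n
    refine ae_of_all _ fun p => ?_
    rw [Real.norm_of_nonneg (by positivity)]
    by_cases hp : p ∈ U
    · rw [Set.indicator_of_mem hp]
      gcongr
      have := norm_setIntegral_le_of_norm_le_const (μ := volume) (s := Set.Ioc 0 M)
        (f := fun s => w s * (trawlSet g (gridFloor n s)).indicator (1 : ℝ × ℝ → ℝ) p) (C := C)
        (by simp) (fun s _ => hbd _ _ _)
      simpa [hM] using this
    · rw [Set.indicator_of_notMem hp, setIntegral_eq_zero_of_forall_eq_zero, abs_zero,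
        Real.zero_rpow hα0.ne']
      intro s hs
      rw [Set.indicator_of_notMem, mul_zero]
      exact fun h => hp (hU _ (gridFloor_nonneg n s) ((gridFloor_le n hs.1.le).trans hs.2) h)
  · refine ae_of_all _ fun p => ?_
    refine (Tendsto.abs ?_).rpow_const (Or.inr hα0.le)
    refine tendsto_integral_of_dominated_convergence (fun _ => C) ?_ ?_ ?_ ?_
    · intro n
      exact ((hmeas _ (measurable_gridFloor n)).comp measurable_prodMk_left).aestronglyMeasurable
    · exact integrable_const _
    · exact fun n => ae_of_all _ fun s => hbd _ _ _
    -- For fixed `p` the times `s` with `p ∈ A_s` form an interval, since `g` decreases. Its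
    -- frontier is null, and off the frontier the rounded times eventually lie on the same side as
    -- `s`.
    · have hconv : (Set.OrdConnected {s : ℝ | p ∈ trawlSet g s}) := by
        refine ⟨fun a ha b hb c hc => ?_⟩
        refine ⟨ha.1.trans hc.1, ha.2.1, hb.2.2.trans ?_⟩
        refine hg.strictAntiOn.antitoneOn (Set.mem_Ici.2 ?_) (Set.mem_Ici.2 ?_) ?_
        · linarith [ha.1, hc.1]
        · linarith [hb.1]
        · linarith [hc.2]
      have hnull := hconv.convex.addHaar_frontier volume
      filter_upwards [ae_restrict_mem measurableSet_Ioc,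
        ae_restrict_of_ae (measure_eq_zero_iff_ae_notMem.1 hnull)] with s hs hsf
      refine tendsto_const_nhds.mul ?_
      have ht := tendsto_gridFloor hs.1.le
      have hs' : s ∈ interior {s : ℝ | p ∈ trawlSet g s} ∪ interior {s : ℝ | p ∈ trawlSet g s}ᶜ := by
        rw [← compl_frontier_eq_union_interior]
        exact hsf
      rcases hs' with h | h
      · have hs1 : p ∈ trawlSet g s := interior_subset (s := {s : ℝ | p ∈ trawlSet g s}) h
        refine tendsto_const_nhds.congr' ?_
        filter_upwards [ht.eventually (mem_interior_iff_mem_nhds.1 h)] with n hn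
        have hn : p ∈ trawlSet g (gridFloor n s) := hn
        simp [hn, hs1]
      · have hs1 : p ∉ trawlSet g s := interior_subset (s := {s : ℝ | p ∈ trawlSet g s}ᶜ) h
        refine tendsto_const_nhds.congr' ?_
        filter_upwards [ht.eventually (mem_interior_iff_mem_nhds.1 h)] with n hn
        have hn : p ∉ trawlSet g (gridFloor n s) := hn
        simp [hn, hs1]

end IsTrawlProcess

end

/-! ### The substitution `y = g(u)` and logarithmic averages. -/

section

variable {α : ℝ} {g : ℝ → ℝ} {γ Cg : ℝ}

namespace AssumptionG

/-- A positive lower bound would contradict the integrability of `g` on a half-line. -/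
lemma exists_lt (hg : AssumptionG g γ Cg) {y : ℝ} (hy : 0 < y) : ∃ u, 0 ≤ u ∧ g u < y := by
  by_contra! h
  have h1 : IntegrableOn (fun _ : ℝ => y) (Set.Ici 0) := by
    refine hg.integrableOn.mono' (by fun_prop) ?_
    refine (ae_restrict_iff' measurableSet_Ici).2 (ae_of_all _ fun u hu => ?_)
    rw [Real.norm_of_nonneg hy.le]
    exact h u hu
  rw [integrableOn_const_iff] at h1
  simp [hy.ne'] at h1

lemma image_Ioi (hg : AssumptionG g γ Cg) : g '' Set.Ioi 0 = Set.Ioo 0 (g 0) := by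
  have hanti : ∀ {a b : ℝ}, 0 ≤ a → a < b → g b < g a := fun ha hab =>
    hg.strictAntiOn (Set.mem_Ici.2 ha) (Set.mem_Ici.2 (ha.trans hab.le)) hab
  ext y
  constructor
  · rintro ⟨u, hu, rfl⟩
    have hu : 0 < u := hu
    exact ⟨(hg.nonneg (u + 1) (by linarith)).trans_lt (hanti hu.le (by linarith)),
      hanti le_rfl hu⟩
  · rintro ⟨hy, hy'⟩
    obtain ⟨u, hu, huy⟩ := hg.exists_lt hy
    obtain ⟨x, hx, rfl⟩ := intermediate_value_Icc' hu
      (hg.continuousOn.mono Set.Icc_subset_Ici_self) ⟨huy.le, hy'.le⟩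
    refine ⟨x, lt_of_le_of_ne hx.1 ?_, rfl⟩
    rintro rfl
    exact lt_irrefl _ hy'

lemma hasDerivAt (hg : AssumptionG g γ Cg) {u : ℝ} (hu : 0 < u) : HasDerivAt g (deriv g u) u :=
  ((hg.contDiffOn.differentiableOn one_ne_zero).differentiableAt (Ioi_mem_nhds hu)).hasDerivAt

/-- The change of variables `y = g(u)`. -/
lemma lintegral_Ioo_eq (hg : AssumptionG g γ Cg) (f : ℝ → ℝ≥0∞) :
    ∫⁻ y in Set.Ioo 0 (g 0), f y =
      ∫⁻ u in Set.Ioi 0, ENNReal.ofReal |deriv g u| * f (g u) := by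
  rw [← hg.image_Ioi]
  exact lintegral_image_eq_lintegral_abs_deriv_mul measurableSet_Ioi
    (fun u hu => (hg.hasDerivAt hu).hasDerivWithinAt)
    (hg.strictAntiOn.injOn.mono Set.Ioi_subset_Ici_self) f

lemma lintegral_abs_deriv (hg : AssumptionG g γ Cg) :
    ∫⁻ u in Set.Ioi 0, ENNReal.ofReal |deriv g u| = ENNReal.ofReal (g 0) := by
  have h := hg.lintegral_Ioo_eq (fun _ => 1)
  simpa using h.symm

lemma exists_rpow_mul_deriv_le (hg : AssumptionG g γ Cg) :
    ∃ B : ℝ, 0 ≤ B ∧ ∀ u, 1 ≤ u → u ^ (2 + γ) * |deriv g u| ≤ B := by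
  obtain ⟨u₀, hu₀⟩ := eventually_atTop.1
    (hg.tendsto_deriv.eventually (eventually_le_nhds (lt_add_one Cg)))
  have hcont : ContinuousOn (fun u : ℝ => u ^ (2 + γ) * |deriv g u|) (Set.Icc 1 u₀) := by
    have hsub : Set.Icc 1 u₀ ⊆ Set.Ioi (0 : ℝ) := fun u hu => zero_lt_one.trans_le hu.1
    refine ContinuousOn.mul ?_ ?_
    · exact continuousOn_id.rpow_const fun u hu => Or.inl (hsub hu).ne'
    · exact ((hg.contDiffOn.continuousOn_deriv_of_isOpen isOpen_Ioi le_rfl).mono hsub).abs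
  obtain ⟨B, hB⟩ := isCompact_Icc.bddAbove_image hcont
  refine ⟨max B (Cg + 1), (by have := hg.const_pos; positivity), fun u hu => ?_⟩
  rcases le_total u u₀ with h | h
  · exact (hB ⟨u, ⟨hu, h⟩, rfl⟩).trans (le_max_left _ _)
  · exact (hu₀ u h).trans (le_max_right _ _)

/-- With `u = T^r`, the measure `du / (u log T)` becomes `dr`, and `u/T = T^{r-1}` tends to zero or
infinity according as `r < 1` or `r > 1`. Only `r ∈ (0,1)`, of length one, survives. -/
lemma tendsto_log_average_Ioi (hg : AssumptionG g γ Cg) {R : ℝ → ℝ≥0∞} (hR : Measurable R)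
    {C : ℝ} (hC0 : 0 ≤ C) (hC : ∀ v, 0 < v → R v ≤ ENNReal.ofReal (C * min 1 (v ^ (-γ)))) {R₀ : ℝ≥0∞}
    (hR₀ : Tendsto R (𝓝[>] 0) (𝓝 R₀)) :
    Tendsto (fun T : ℝ => ∫⁻ u in Set.Ioi 1,
      ENNReal.ofReal (|deriv g u| * u ^ (1 + γ) / Real.log T) * R (u / T)) atTop
      (𝓝 (ENNReal.ofReal Cg * R₀)) := by
  have hγ := hg.gamma_pos
  obtain ⟨B, hB0, hB⟩ := hg.exists_rpow_mul_deriv_le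
  let k : ℝ → ℝ := fun u => u ^ (2 + γ) * |deriv g u|
  have hkm : Measurable k := by
    have := measurable_deriv g
    fun_prop
  have hsub : ∀ T : ℝ, 1 < T → ∫⁻ u in Set.Ioi 1,
      ENNReal.ofReal (|deriv g u| * u ^ (1 + γ) / Real.log T) * R (u / T) =
      ∫⁻ r in Set.Ioi 0, ENNReal.ofReal (k (Real.exp (Real.log T * r))) *
        R (Real.exp (Real.log T * (r - 1))) := by
    intro T hT
    have hL : 0 < Real.log T := Real.log_pos hT
    have himg : (fun r => Real.exp (Real.log T * r)) '' Set.Ioi 0 = Set.Ioi 1 := by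
      ext u
      constructor
      · rintro ⟨r, hr, rfl⟩
        exact Real.one_lt_exp_iff.2 (mul_pos hL hr)
      · intro hu
        have hu : 1 < u := hu
        refine ⟨Real.log u / Real.log T, div_pos (Real.log_pos hu) hL, ?_⟩
        simp only
        rw [mul_div_cancel₀ _ hL.ne', Real.exp_log (by linarith)]
    have hinj : Set.InjOn (fun r => Real.exp (Real.log T * r)) (Set.Ioi 0) := fun a _ b _ hab =>
      mul_left_cancel₀ hL.ne' (Real.exp_injective hab)
    rw [← himg, lintegral_image_eq_lintegral_abs_deriv_mul measurableSet_Ioi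
      (f := fun r => Real.exp (Real.log T * r))
      (f' := fun r => Real.exp (Real.log T * r) * (Real.log T * 1))
      (fun r _ => (((hasDerivAt_id r).const_mul _).exp).hasDerivWithinAt) hinj]
    refine lintegral_congr fun r => ?_
    rw [← mul_assoc, ← ENNReal.ofReal_mul (abs_nonneg _)]
    congr 2
    · have he := Real.exp_pos (Real.log T * r)
      simp only [k]
      rw [abs_of_pos (by positivity), show 2 + γ = 1 + (1 + γ) by ring, Real.rpow_add he 1 (1 + γ),
        Real.rpow_one]
      generalize Real.exp (Real.log T * r) ^ (1 + γ) = a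
      field_simp
    · rw [mul_sub, mul_one, Real.exp_sub, Real.exp_log (by linarith)]
  have hR0fin : R₀ ≠ ⊤ := by
    refine (lt_of_le_of_lt (le_of_tendsto hR₀ ?_) (ENNReal.ofReal_lt_top (r := C))).ne
    filter_upwards [self_mem_nhdsWithin] with v hv
    refine (hC v hv).trans (ENNReal.ofReal_le_ofReal ?_)
    exact mul_le_of_le_one_right hC0 (min_le_left _ _)
  have hlim : ∫⁻ r in Set.Ioi 0,
      (Set.Iio (1 : ℝ)).indicator (fun _ => ENNReal.ofReal Cg * R₀) r = ENNReal.ofReal Cg * R₀ := by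
    rw [lintegral_indicator measurableSet_Iio, Measure.restrict_restrict measurableSet_Iio,
      Set.inter_comm, Set.Ioi_inter_Iio, setLIntegral_const]
    simp
  rw [← hlim]
  refine Tendsto.congr' (f₁ := fun T : ℝ => ∫⁻ r in Set.Ioi 0,
    ENNReal.ofReal (k (Real.exp (Real.log T * r))) * R (Real.exp (Real.log T * (r - 1)))) ?_ ?_
  · filter_upwards [eventually_gt_atTop 1] with T hT
    exact (hsub T hT).symm
  -- For `log T ≥ 1`, `min 1 (T^{-γ(r-1)}) ≤ e^{-γ(r-1)}` for both signs of `r - 1`, which gives a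
  -- majorant independent of `T`.
  refine tendsto_lintegral_filter_of_dominated_convergence
    (fun r => ENNReal.ofReal (B * (C * Real.exp (-γ * r + γ)))) ?_ ?_ ?_ ?_
  · refine .of_forall fun T => ?_
    fun_prop
  · filter_upwards [Real.tendsto_log_atTop.eventually_ge_atTop 1] with T hT
    refine (ae_restrict_iff' measurableSet_Ioi).2 (ae_of_all _ fun r hr => ?_)
    have hr : 0 < r := hr
    rw [ENNReal.ofReal_mul hB0]
    refine mul_le_mul' (ENNReal.ofReal_le_ofReal (hB _ (Real.one_le_exp (by positivity)))) ?_
    refine (hC _ (Real.exp_pos _)).trans (ENNReal.ofReal_le_ofReal ?_)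
    gcongr
    rw [← Real.exp_mul]
    rcases le_total r 1 with h | h
    · exact (min_le_left _ _).trans (Real.one_le_exp (by nlinarith))
    · refine (min_le_right _ _).trans (Real.exp_le_exp.2 ?_)
      have : 0 ≤ γ * ((r - 1) * (Real.log T - 1)) :=
        mul_nonneg hγ.le (mul_nonneg (by linarith) (by linarith))
      nlinarith
  · have h1 := (((exp_neg_integrableOn_Ioi 0 hγ).mul_const (Real.exp γ)).const_mul C).const_mul B
    simp_rw [Real.exp_add]
    exact h1.lintegral_lt_top.ne
  · refine (ae_restrict_iff' measurableSet_Ioi).2 ?_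
    have hne : ∀ᵐ r : ℝ, r ≠ 1 := by simp [ae_iff]
    filter_upwards [hne] with r hr1 hr
    have hr : 0 < r := hr
    rcases lt_or_gt_of_ne hr1 with h | h
    · rw [Set.indicator_of_mem (Set.mem_Iio.2 h)]
      have hv : Tendsto (fun T : ℝ => Real.exp (Real.log T * (r - 1))) atTop (𝓝[>] 0) := by
        refine tendsto_nhdsWithin_iff.2 ⟨Real.tendsto_exp_atBot.comp ?_,
          .of_forall fun T => Real.exp_pos _⟩
        exact Real.tendsto_log_atTop.atTop_mul_const_of_neg (by linarith)
      have hu : Tendsto (fun T : ℝ => Real.exp (Real.log T * r)) atTop atTop :=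
        Real.tendsto_exp_atTop.comp (Real.tendsto_log_atTop.atTop_mul_const hr)
      exact ENNReal.Tendsto.mul (ENNReal.tendsto_ofReal (hg.tendsto_deriv.comp hu))
        (Or.inr hR0fin) (hR₀.comp hv) (Or.inr ENNReal.ofReal_ne_top)
    · rw [Set.indicator_of_notMem (by simpa using h.le)]
      have hv : Tendsto (fun T : ℝ => ENNReal.ofReal (B * (C *
          Real.exp (Real.log T * (-γ * (r - 1)))))) atTop (𝓝 (ENNReal.ofReal (B * (C * 0)))) := by
        refine ENNReal.tendsto_ofReal (Tendsto.const_mul _ (Tendsto.const_mul _ ?_))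
        refine Real.tendsto_exp_atBot.comp ?_
        exact Real.tendsto_log_atTop.atTop_mul_const_of_neg (by nlinarith)
      rw [mul_zero, mul_zero, ENNReal.ofReal_zero] at hv
      refine tendsto_of_tendsto_of_tendsto_of_le_of_le' tendsto_const_nhds hv
        (.of_forall fun _ => zero_le) ?_
      filter_upwards [eventually_ge_atTop 1] with T hT
      have hL := Real.log_nonneg hT
      rw [ENNReal.ofReal_mul hB0]
      refine mul_le_mul' (ENNReal.ofReal_le_ofReal (hB _ (Real.one_le_exp (by positivity)))) ?_
      refine (hC _ (Real.exp_pos _)).trans (ENNReal.ofReal_le_ofReal ?_)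
      gcongr
      refine (min_le_right _ _).trans (le_of_eq ?_)
      rw [← Real.exp_mul]
      congr 1
      ring

/-- The logarithmic average that governs the limit of the integrated trawl process. -/
lemma tendsto_log_average (hg : AssumptionG g γ Cg) {R : ℝ → ℝ≥0∞} (hR : Measurable R)
    {C : ℝ} (hC0 : 0 ≤ C) (hC : ∀ v, 0 < v → R v ≤ ENNReal.ofReal (C * min 1 (v ^ (-γ)))) {R₀ : ℝ≥0∞}
    (hR₀ : Tendsto R (𝓝[>] 0) (𝓝 R₀)) :
    Tendsto (fun T : ℝ => ∫⁻ u in Set.Ioi 0,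
      ENNReal.ofReal (|deriv g u| * u ^ (1 + γ) / Real.log T) * R (u / T)) atTop
      (𝓝 (ENNReal.ofReal Cg * R₀)) := by
  have hγ := hg.gamma_pos
  -- Lifetimes `u ≤ 1` contribute `O(1 / log T)`: `g'` may be unbounded near zero, but `∫ |g'| = g
  -- 0`.
  have h0 : Tendsto (fun T : ℝ => ∫⁻ u in Set.Ioc 0 1,
      ENNReal.ofReal (|deriv g u| * u ^ (1 + γ) / Real.log T) * R (u / T)) atTop (𝓝 0) := by
    have hlim : Tendsto (fun T : ℝ => ENNReal.ofReal (C / Real.log T) * ENNReal.ofReal (g 0)) atTop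
        (𝓝 0) := by
      have := ENNReal.Tendsto.mul_const (b := ENNReal.ofReal (g 0)) (ENNReal.tendsto_ofReal
        (Real.tendsto_log_atTop.const_div_atTop C)) (Or.inr ENNReal.ofReal_ne_top)
      simpa using this
    refine tendsto_of_tendsto_of_tendsto_of_le_of_le' tendsto_const_nhds hlim
      (.of_forall fun _ => zero_le) ?_
    filter_upwards [eventually_gt_atTop 1] with T hT
    have hL := Real.log_pos hT
    rw [← hg.lintegral_abs_deriv, ← lintegral_const_mul]
    · refine (setLIntegral_mono' measurableSet_Ioc fun u hu => ?_).trans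
        (lintegral_mono_set Set.Ioc_subset_Ioi_self)
      have hu0 : 0 < u := hu.1
      have h1 : R (u / T) ≤ ENNReal.ofReal C := by
        refine (hC _ (by positivity)).trans (ENNReal.ofReal_le_ofReal ?_)
        exact mul_le_of_le_one_right hC0 (min_le_left _ _)
      refine (mul_le_mul' le_rfl h1).trans ?_
      rw [← ENNReal.ofReal_mul (by positivity), ← ENNReal.ofReal_mul (by positivity)]
      refine ENNReal.ofReal_le_ofReal ?_
      have h2 : u ^ (1 + γ) ≤ 1 := Real.rpow_le_one hu0.le hu.2 (by linarith)
      rw [div_mul_eq_mul_div, div_mul_eq_mul_div, mul_comm C]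
      gcongr
      exact mul_le_of_le_one_right (abs_nonneg _) h2
    · have := measurable_deriv g
      fun_prop
  have h := h0.add (hg.tendsto_log_average_Ioi hR hC0 hC hR₀)
  rw [zero_add] at h
  refine h.congr fun T => ?_
  rw [← Set.Ioc_union_Ioi_eq_Ioi zero_le_one, lintegral_union measurableSet_Ioi]
  exact Set.Ioc_disjoint_Ioi le_rfl

end AssumptionG

end

/-! ### Window averages of a weight and the asymptotics of the exponent. -/

section

variable {α : ℝ} {g : ℝ → ℝ} {γ Cg : ℝ} {w : ℝ → ℝ} {C M : ℝ}

/-- The integral of the `α`-th power of the moving averages of `w` over windows of length `v`. -/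
def windowPower (α : ℝ) (w : ℝ → ℝ) (v : ℝ) : ℝ≥0∞ :=
  ∫⁻ x, ENNReal.ofReal (|(∫ s in x..x + v, w s) / v| ^ α)

/-- A bounded measurable weight function supported in `(0, M]`. -/
structure IsWeight (w : ℝ → ℝ) (C M : ℝ) : Prop where
  measurable : Measurable w
  abs_le : ∀ s, |w s| ≤ C
  eq_zero : ∀ s, s ∉ Set.Ioc 0 M → w s = 0

namespace IsWeight

lemma bound_nonneg (hw : IsWeight w C M) : 0 ≤ C := (abs_nonneg _).trans (hw.abs_le 0)

lemma integrable (hw : IsWeight w C M) : Integrable w := by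
  have h : IntegrableOn w (Set.Ioc 0 M) :=
    Measure.integrableOn_of_bounded (M := C) (by simp) hw.measurable.aestronglyMeasurable
      (ae_of_all _ hw.abs_le)
  rw [← integrable_indicator_iff measurableSet_Ioc] at h
  refine h.congr (ae_of_all _ fun s => ?_)
  by_cases hs : s ∈ Set.Ioc 0 M
  · rw [Set.indicator_of_mem hs]
  · rw [Set.indicator_of_notMem hs, hw.eq_zero s hs]

lemma intervalIntegral_eq (hw : IsWeight w C M) (x v : ℝ) :
    ∫ s in x..x + v, w s = (∫ s in (0 : ℝ)..x + v, w s) - ∫ s in (0 : ℝ)..x, w s :=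
  (intervalIntegral.integral_interval_sub_left hw.integrable.intervalIntegrable
    hw.integrable.intervalIntegrable).symm

lemma measurable_window (hw : IsWeight w C M) :
    Measurable fun q : ℝ × ℝ => ∫ s in q.1..q.1 + q.2, w s := by
  simp_rw [hw.intervalIntegral_eq]
  have h : Measurable fun x : ℝ => ∫ s in (0 : ℝ)..x, w s :=
    (intervalIntegral.continuous_primitive (fun _ _ => hw.integrable.intervalIntegrable) 0).measurable
  exact (h.comp (by fun_prop)).sub (h.comp (by fun_prop))

lemma measurable_windowPower (hw : IsWeight w C M) : Measurable (windowPower α w) := by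
  have h : Measurable fun q : ℝ × ℝ =>
      ENNReal.ofReal (|(∫ s in q.2..q.2 + q.1, w s) / q.1| ^ α) := by
    have := hw.measurable_window.comp measurable_swap
    exact (((this.div measurable_fst).abs).pow_const α).ennreal_ofReal
  exact h.lintegral_prod_right'

lemma abs_window_le (hw : IsWeight w C M) (x : ℝ) {v : ℝ} (hv : 0 ≤ v) :
    |∫ s in x..x + v, w s| ≤ C * v := by
  have h := intervalIntegral.norm_integral_le_of_norm_le_const (a := x) (b := x + v) (f := w)
    (fun s _ => hw.abs_le s)
  simpa [abs_of_nonneg hv] using h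

lemma abs_window_le' (hw : IsWeight w C M) (hM : 0 ≤ M) (x : ℝ) {v : ℝ} (hv : 0 ≤ v) :
    |∫ s in x..x + v, w s| ≤ C * M := by
  have hC := hw.bound_nonneg
  rw [intervalIntegral.integral_of_le (by linarith), ← Real.norm_eq_abs]
  calc _ ≤ ∫ s in Set.Ioc x (x + v), ‖w s‖ := norm_integral_le_integral_norm _
    _ ≤ ∫ s, ‖w s‖ := setIntegral_le_integral hw.integrable.norm (ae_of_all _ fun s => norm_nonneg _)
    _ = ∫ s in Set.Ioc 0 M, ‖w s‖ := (setIntegral_eq_integral_of_forall_compl_eq_zero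
          fun s hs => by rw [hw.eq_zero s hs, norm_zero]).symm
    _ ≤ C * M := by
        have h := norm_setIntegral_le_of_norm_le_const (μ := volume) (s := Set.Ioc 0 M)
          (f := fun s => ‖w s‖) (C := C) (by simp)
          (fun s _ => by rw [norm_norm]; exact hw.abs_le s)
        refine (le_abs_self _).trans ?_
        simpa [hM] using h

lemma window_eq_zero (hw : IsWeight w C M) {x v : ℝ} (hv : 0 ≤ v)
    (hx : x ∉ Set.Ioc (-v) M) : ∫ s in x..x + v, w s = 0 := by
  rw [intervalIntegral.integral_of_le (by linarith)]
  refine setIntegral_eq_zero_of_forall_eq_zero fun s hs => hw.eq_zero s fun h => hx ?_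
  exact ⟨by linarith [hs.2, h.1], hs.1.le.trans h.2⟩

lemma rpow_window_le (hw : IsWeight w C M) (hα : 0 < α) {v : ℝ} (hv : 0 < v) {b : ℝ}
    (hb : ∀ x, |∫ s in x..x + v, w s| ≤ b * v) (x : ℝ) :
    ENNReal.ofReal (|(∫ s in x..x + v, w s) / v| ^ α) ≤
      (Set.Ioc (-v) M).indicator (fun _ => ENNReal.ofReal (b ^ α)) x := by
  by_cases hx : x ∈ Set.Ioc (-v) M
  · rw [Set.indicator_of_mem hx]
    refine ENNReal.ofReal_le_ofReal ?_
    gcongr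
    rw [abs_div, abs_of_pos hv, div_le_iff₀ hv]
    exact hb x
  · rw [hw.window_eq_zero hv.le hx, zero_div, abs_zero, Real.zero_rpow hα.ne', ENNReal.ofReal_zero]
    exact zero_le

lemma windowPower_le_of_window (hw : IsWeight w C M) (hα : 0 < α) {v : ℝ} (hv : 0 < v) {b : ℝ}
    (hb0 : 0 ≤ b) (hb : ∀ x, |∫ s in x..x + v, w s| ≤ b * v) :
    windowPower α w v ≤ ENNReal.ofReal (b ^ α * (M + v)) := by
  refine (lintegral_mono (hw.rpow_window_le hα hv hb)).trans ?_
  rw [lintegral_indicator measurableSet_Ioc, setLIntegral_const, Real.volume_Ioc,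
    ENNReal.ofReal_mul (by positivity), sub_neg_eq_add]

/-- The averages vanish off an interval of length `M + v`. They are at most `C` always, and at most
`C M / v` because `w` has total mass at most `C M`; for large `v` this leaves `v · v^{-(1+γ)} =
v^{-γ}`. -/
lemma windowPower_le (hw : IsWeight w C M) (hγ : 0 < γ) (hM : 0 ≤ M) {v : ℝ} (hv : 0 < v) :
    windowPower (1 + γ) w v ≤
      ENNReal.ofReal ((M + 1) * (C ^ (1 + γ) + (C * M) ^ (1 + γ)) * min 1 (v ^ (-γ))) := by
  have hC := hw.bound_nonneg
  have h1 : 0 ≤ C ^ (1 + γ) := by positivity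
  have h2 : 0 ≤ (C * M) ^ (1 + γ) := by positivity
  rcases le_total v 1 with h | h
  · refine (hw.windowPower_le_of_window (by linarith) hv hC
      fun x => hw.abs_window_le x hv.le).trans (ENNReal.ofReal_le_ofReal ?_)
    rw [min_eq_left (Real.one_le_rpow_of_pos_of_le_one_of_nonpos hv h (by linarith)), mul_one,
      mul_comm]
    gcongr
    linarith
  · refine (hw.windowPower_le_of_window (b := C * M / v) (by linarith) hv (by positivity)
      fun x => ?_).trans (ENNReal.ofReal_le_ofReal ?_)
    · rw [div_mul_cancel₀ _ hv.ne']
      exact hw.abs_window_le' hM x hv.le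
    · rw [min_eq_right (Real.rpow_le_one_of_one_le_of_nonpos h (by linarith)),
        Real.div_rpow (by positivity) hv.le, Real.rpow_add hv, Real.rpow_one, Real.rpow_neg hv.le]
      calc (C * M) ^ (1 + γ) / (v * v ^ γ) * (M + v)
          ≤ (C * M) ^ (1 + γ) / (v * v ^ γ) * ((M + 1) * v) := by gcongr; nlinarith
        _ = (M + 1) * (0 + (C * M) ^ (1 + γ)) * (v ^ γ)⁻¹ := by field_simp; ring
        _ ≤ _ := by gcongr

/-- Lebesgue differentiation gives pointwise convergence almost everywhere; the averages are bounded
with common bounded support once `v < 1`. -/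
lemma tendsto_windowPower (hw : IsWeight w C M) (hα : 0 < α) :
    Tendsto (windowPower α w) (𝓝[>] 0) (𝓝 (∫⁻ x, ENNReal.ofReal (|w x| ^ α))) := by
  have hC := hw.bound_nonneg
  refine tendsto_lintegral_filter_of_dominated_convergence
    ((Set.Ioc (-1) M).indicator fun _ => ENNReal.ofReal (C ^ α)) ?_ ?_ ?_ ?_
  · refine .of_forall fun v => ?_
    have h := hw.measurable_window.comp (measurable_prodMk_right (y := v))
    exact (((h.div_const v).abs).pow_const α).ennreal_ofReal
  · filter_upwards [self_mem_nhdsWithin, mem_nhdsWithin_of_mem_nhds (Iio_mem_nhds one_pos)]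
      with v hv hv1
    have hv : 0 < v := hv
    have hv1 : v < 1 := hv1
    refine ae_of_all _ fun x => (hw.rpow_window_le hα hv
      (fun x => hw.abs_window_le x hv.le) x).trans ?_
    exact Set.indicator_le_indicator_of_subset (Set.Ioc_subset_Ioc_left (by linarith))
      (fun _ => zero_le) x
  · rw [lintegral_indicator measurableSet_Ioc, setLIntegral_const, Real.volume_Ioc]
    exact ENNReal.mul_ne_top ENNReal.ofReal_ne_top ENNReal.ofReal_ne_top
  · filter_upwards [LocallyIntegrable.ae_hasDerivAt_integral hw.integrable.locallyIntegrable] with x hx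
    have h := (hasDerivAt_iff_tendsto_slope_zero.1 (hx 0)).mono_left
      (nhdsWithin_mono 0 fun v (hv : 0 < v) => hv.ne')
    refine ENNReal.tendsto_ofReal ((Tendsto.abs ?_).rpow_const (Or.inr hα.le))
    refine h.congr fun v => ?_
    rw [hw.intervalIntegral_eq, smul_eq_mul, div_eq_inv_mul]

end IsWeight

lemma trawlSet_indicator_apply (hg : AssumptionG g γ Cg) {u : ℝ} (hu : 0 < u) (s x : ℝ) :
    (trawlSet g s).indicator (1 : ℝ × ℝ → ℝ) (x, g u) = (Set.Icc x (x + u)).indicator 1 s := by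
  have h : (x, g u) ∈ trawlSet g s ↔ s ∈ Set.Icc x (x + u) := by
    simp only [trawlSet, Set.mem_ofPred_eq, Set.mem_Icc]
    refine and_congr_right fun hx => ?_
    rw [hg.strictAntiOn.le_iff_ge (Set.mem_Ici.2 hu.le) (Set.mem_Ici.2 (by linarith))]
    constructor
    · rintro ⟨_, h⟩; linarith
    · intro h; exact ⟨hg.nonneg _ hu.le, by linarith⟩
  by_cases hs : s ∈ Set.Icc x (x + u)
  · rw [Set.indicator_of_mem hs, Set.indicator_of_mem (h.2 hs)]; rfl
  · rw [Set.indicator_of_notMem hs, Set.indicator_of_notMem (fun h' => hs (h.1 h'))]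

lemma measurable_const_mul_comp_div (hw : Measurable w) (c T : ℝ) :
    Measurable fun s => c * w (s / T) := by fun_prop

lemma measurable_setIntegral_trawl (hg : AssumptionG g γ Cg) {f : ℝ → ℝ} (hf : Measurable f)
    (S : Set ℝ) : Measurable fun p => ∫ s in S, f s * (trawlSet g s).indicator 1 p := by
  have h1 : Measurable fun q : (ℝ × ℝ) × ℝ =>
      f q.2 * (trawlSet g q.2).indicator (1 : ℝ × ℝ → ℝ) q.1 :=
    (hf.comp measurable_snd).mul ((measurable_const (a := (1 : ℝ))).indicator
      (measurable_swap hg.measurableSet_trawl_prod))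
  exact (h1.stronglyMeasurable.integral_prod_right' (ν := volume.restrict S)).measurable

lemma lintegral_comp_div (f : ℝ → ℝ≥0∞) (hf : Measurable f) {T : ℝ} (hT : 0 < T) :
    ∫⁻ x, f (x / T) = ENNReal.ofReal T * ∫⁻ x, f x := by
  conv_lhs => rw [← Real.smul_map_volume_mul_left hT.ne', lintegral_smul_measure,
    lintegral_map (by fun_prop) (by fun_prop)]
  rw [abs_of_pos hT, smul_eq_mul]
  simp_rw [mul_div_cancel_left₀ _ hT.ne']

namespace IsWeight

lemma setIntegral_trawl (hw : IsWeight w C M) (hg : AssumptionG g γ Cg) {T : ℝ} (hT : 0 < T)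
    (c : ℝ) {u : ℝ} (hu : 0 < u) (x : ℝ) :
    ∫ s in Set.Ioc 0 (T * M), (c * w (s / T)) * (trawlSet g s).indicator 1 (x, g u) =
      c * T * ∫ s in x / T..x / T + u / T, w s := by
  rw [setIntegral_eq_integral_of_forall_compl_eq_zero]
  · simp_rw [trawlSet_indicator_apply hg hu]
    have h : ∀ s, c * w (s / T) * (Set.Icc x (x + u)).indicator (1 : ℝ → ℝ) s =
        (Set.Icc x (x + u)).indicator (fun s => c * w (s / T)) s := by
      intro s
      by_cases hs : s ∈ Set.Icc x (x + u) <;> simp [hs]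
    simp_rw [h]
    rw [integral_indicator measurableSet_Icc, integral_Icc_eq_integral_Ioc,
      ← intervalIntegral.integral_of_le (by linarith), intervalIntegral.integral_const_mul,
      intervalIntegral.integral_comp_div _ hT.ne', add_div, smul_eq_mul, mul_assoc]
  · intro s hs
    rw [hw.eq_zero (s / T), mul_zero, zero_mul]
    intro h
    exact hs ⟨by simpa [hT] using h.1, by have := h.2; rwa [div_le_iff₀' hT] at this⟩

/-- Slicing at height `y = g(u)` replaces the trawl indicator by a window of length `u`; the
substitution `x ↦ x / T` produces the factor `T` and the window length `u / T`. -/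
lemma lintegral_trawl (hw : IsWeight w C M) (hg : AssumptionG g γ Cg) (hα : 0 < α) {T : ℝ}
    (hT : 0 < T) {c : ℝ} (hc : 0 ≤ c) :
    ∫⁻ p, ENNReal.ofReal (|∫ s in Set.Ioc 0 (T * M),
      (c * w (s / T)) * (trawlSet g s).indicator 1 p| ^ α) =
    ∫⁻ u in Set.Ioi 0, ENNReal.ofReal (|deriv g u| * ((c * u) ^ α * T)) *
      windowPower α w (u / T) := by
  have hm := ((measurable_setIntegral_trawl hg (measurable_const_mul_comp_div hw.measurable c T)
    (Set.Ioc 0 (T * M))).abs.pow_const α).ennreal_ofReal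
  rw [Measure.volume_eq_prod, lintegral_prod_symm' _ hm]
  have hsupp : ∀ᵐ y : ℝ, y ∉ Set.Ioo 0 (g 0) → ∫⁻ x, ENNReal.ofReal (|∫ s in Set.Ioc 0 (T * M),
      (c * w (s / T)) * (trawlSet g s).indicator 1 (x, y)| ^ α) = 0 := by
    have h0 : ∀ᵐ y : ℝ, y ≠ 0 := by simp [ae_iff]
    have h1 : ∀ᵐ y : ℝ, y ≠ g 0 := by simp [ae_iff]
    filter_upwards [h0, h1] with y hy0 hy1 hy
    have hz : ∀ s x : ℝ, (trawlSet g s).indicator (1 : ℝ × ℝ → ℝ) (x, y) = 0 := by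
      intro s x
      refine Set.indicator_of_notMem ?_ _
      rintro ⟨h1, h2, h3⟩
      simp only at h1 h2 h3
      exact hy ⟨lt_of_le_of_ne h2 hy0.symm,
        lt_of_le_of_ne (h3.trans (hg.le_zero (by linarith))) hy1⟩
    simp [hz, Real.zero_rpow hα.ne']
  have hset : ∀ F : ℝ → ℝ≥0∞, (∀ᵐ y : ℝ, y ∉ Set.Ioo 0 (g 0) → F y = 0) →
      ∫⁻ y, F y = ∫⁻ y in Set.Ioo 0 (g 0), F y := by
    intro F hF
    rw [← lintegral_indicator measurableSet_Ioo]
    refine lintegral_congr_ae ?_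
    filter_upwards [hF] with y hy
    by_cases h : y ∈ Set.Ioo 0 (g 0)
    · rw [Set.indicator_of_mem h]
    · rw [Set.indicator_of_notMem h, hy h]
  rw [hset _ hsupp, hg.lintegral_Ioo_eq]
  refine setLIntegral_congr_fun measurableSet_Ioi fun u hu => ?_
  have hu : 0 < u := hu
  simp_rw [hw.setIntegral_trawl hg hT c hu]
  have hpt : ∀ x, ENNReal.ofReal (|c * T * ∫ s in x / T..x / T + u / T, w s| ^ α) =
      ENNReal.ofReal ((c * u) ^ α) *
        ENNReal.ofReal (|(∫ s in x / T..x / T + u / T, w s) / (u / T)| ^ α) := by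
    intro x
    rw [← ENNReal.ofReal_mul (by positivity), ← Real.mul_rpow (by positivity) (abs_nonneg _)]
    congr 2
    have habs : |c * u * ((∫ s in x / T..x / T + u / T, w s) / (u / T))| =
        c * u * |(∫ s in x / T..x / T + u / T, w s) / (u / T)| := by
      rw [abs_mul, abs_of_nonneg (mul_nonneg hc hu.le)]
    rw [← habs]
    congr 1
    field_simp
  simp_rw [hpt]
  have hm2 : Measurable fun x : ℝ =>
      ENNReal.ofReal (|(∫ s in x..x + u / T, w s) / (u / T)| ^ α) := by
    have h := hw.measurable_window.comp (measurable_prodMk_right (y := u / T))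
    exact (((h.div_const _).abs).pow_const α).ennreal_ofReal
  have hm3 : Measurable fun x : ℝ =>
      ENNReal.ofReal (|(∫ s in x / T..x / T + u / T, w s) / (u / T)| ^ α) :=
    hm2.comp (by fun_prop : Measurable fun x : ℝ => x / T)
  rw [lintegral_const_mul _ hm3,
    lintegral_comp_div (fun x => ENNReal.ofReal (|(∫ s in x..x + u / T, w s) / (u / T)| ^ α)) hm2 hT,
    ← windowPower, ENNReal.ofReal_mul (abs_nonneg _), ENNReal.ofReal_mul (by positivity)]
  ring

/-- The asymptotics of the scale of the integrated trawl process. -/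
lemma tendsto_integral_trawl (hw : IsWeight w C M) (hM : 0 ≤ M) (hg : AssumptionG g γ Cg)
    (hα : α = 1 + γ) :
    Tendsto (fun T : ℝ => ∫ p, |∫ s in Set.Ioc 0 (T * M),
      (1 / (T * Real.log T) ^ (1 / α) * w (s / T)) * (trawlSet g s).indicator 1 p| ^ α) atTop
      (𝓝 (Cg * ∫ x, |w x| ^ α)) := by
  have hγ := hg.gamma_pos
  have hα0 : 0 < α := by linarith
  have hC := hw.bound_nonneg
  have h := hg.tendsto_log_average (hw.measurable_windowPower (α := α))
    (C := (M + 1) * (C ^ (1 + γ) + (C * M) ^ (1 + γ))) (by positivity)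
    (fun v hv => hα ▸ hw.windowPower_le hγ hM hv) (hw.tendsto_windowPower hα0)
  have hfin : ∫⁻ x, ENNReal.ofReal (|w x| ^ α) ≠ ⊤ := by
    refine ne_top_of_le_ne_top (b := ∫⁻ x, (Set.Ioc 0 M).indicator
      (fun _ => ENNReal.ofReal (C ^ α)) x) ?_ (lintegral_mono fun x => ?_)
    · rw [lintegral_indicator measurableSet_Ioc, setLIntegral_const, Real.volume_Ioc]
      exact ENNReal.mul_ne_top ENNReal.ofReal_ne_top ENNReal.ofReal_ne_top
    · by_cases hx : x ∈ Set.Ioc 0 M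
      · rw [Set.indicator_of_mem hx]
        refine ENNReal.ofReal_le_ofReal ?_
        have := hw.abs_le x
        gcongr
      · simp [hw.eq_zero x hx, Real.zero_rpow hα0.ne']
  have h2 := (ENNReal.tendsto_toReal (ENNReal.mul_ne_top ENNReal.ofReal_ne_top hfin)).comp h
  have hlim : (ENNReal.ofReal Cg * ∫⁻ x, ENNReal.ofReal (|w x| ^ α)).toReal =
      Cg * ∫ x, |w x| ^ α := by
    rw [ENNReal.toReal_mul, ENNReal.toReal_ofReal hg.const_pos.le,
      integral_eq_lintegral_of_nonneg_ae (ae_of_all _ fun x => by positivity)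
        ((hw.measurable.abs.pow_const α).aestronglyMeasurable)]
  rw [hlim] at h2
  refine h2.congr' ?_
  filter_upwards [eventually_gt_atTop 1] with T hT
  have hT0 : 0 < T := by linarith
  have hL := Real.log_pos hT
  rw [integral_eq_lintegral_of_nonneg_ae (ae_of_all _ fun p => by positivity),
    hw.lintegral_trawl hg hα0 hT0 (by positivity), Function.comp_apply]
  · congr 1
    refine setLIntegral_congr_fun measurableSet_Ioi fun u hu => ?_
    have hu : 0 < u := hu
    congr 3
    -- The normalisation enters here: `T · F_T^{-α} = 1 / log T`.
    rw [Real.mul_rpow (by positivity) hu.le, Real.div_rpow zero_le_one (by positivity),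
      ← Real.rpow_mul (by positivity), one_div_mul_cancel hα0.ne', Real.one_rpow, Real.rpow_one,
      ← hα]
    field_simp
  · exact ((measurable_setIntegral_trawl hg (measurable_const_mul_comp_div hw.measurable _ T)
      (Set.Ioc 0 (T * M))).abs.pow_const α).aestronglyMeasurable

end IsWeight

end

/-! ### Finite-dimensional distributions and the continuity theorem. -/

section

variable {Ω : Type*} [MeasurableSpace Ω] {P : Measure Ω} {ν : Measure ℝ}
  {Λ : Set (ℝ × ℝ) → Ω → ℝ} {α : ℝ} {g : ℝ → ℝ} {γ Cg : ℝ} {X : ℝ → Ω → ℝ}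

/-- Finitely many times lie on a nondecreasing sequence that starts at `0`. -/
lemma exists_monotone_seq {n : ℕ} (t : Fin n → ℝ≥0) :
    ∃ (s : ℕ → ℝ≥0) (k : Fin n → ℕ), Monotone s ∧ s 0 = 0 ∧ ∀ j, t j = s (k j) := by
  classical
  let S : Finset ℝ≥0 := insert 0 (Finset.univ.image t)
  have h0 : (0 : ℝ≥0) ∈ S := Finset.mem_insert_self _ _
  have hpos : 0 < S.card := Finset.card_pos.2 ⟨0, h0⟩
  let e := S.orderIsoOfFin rfl
  -- The increasing enumeration of the times together with `0`, continued by its largest value.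
  refine ⟨fun i => e ⟨min i (S.card - 1), by omega⟩,
    fun j => e.symm ⟨t j, Finset.mem_insert_of_mem (Finset.mem_image_of_mem t (Finset.mem_univ j))⟩,
    fun a b hab => ?_, ?_, fun j => ?_⟩
  · exact e.monotone (by simp only [Fin.mk_le_mk]; omega)
  · have h : e ⟨min 0 (S.card - 1), by omega⟩ ≤ ⟨0, h0⟩ := by
      rw [← e.apply_symm_apply ⟨0, h0⟩]
      exact e.monotone (by simp [Fin.le_def])
    exact le_antisymm h zero_le
  · have h : ∀ i : Fin S.card, (⟨min i (S.card - 1), by omega⟩ : Fin S.card) = i := fun i =>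
      Fin.ext (by simp only; omega)
    simp only [h, e.apply_symm_apply]

/-- Summation by parts. It is applied both to the paths of `ξ` and to `r ↦ 1_{(0,r]}(x)`, so the
same coefficients appear on the increments and on the disjoint intervals. -/
lemma sum_mul_eq_sum_increments {n N : ℕ} (θ : Fin n → ℝ) {s : ℕ → ℝ≥0} {k : Fin n → ℕ}
    (hk : ∀ j, k j ≤ N) {f : ℝ≥0 → ℝ} (hf : f (s 0) = 0) :
    ∑ j, θ j * f (s (k j)) =
      ∑ i : Fin N, (∑ j, if (i : ℕ) < k j then θ j else 0) * (f (s (i + 1)) - f (s i)) := by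
  rw [Fin.sum_univ_eq_sum_range
    (fun i => (∑ j, if i < k j then θ j else 0) * (f (s (i + 1)) - f (s i))) N]
  simp_rw [Finset.sum_mul]
  rw [Finset.sum_comm]
  refine Finset.sum_congr rfl fun j _ => ?_
  have h := Finset.sum_range_sub (fun i => f (s i)) (k j)
  rw [hf, sub_zero] at h
  rw [← h, Finset.mul_sum]
  simp_rw [ite_mul, zero_mul]
  rw [← Finset.sum_filter]
  refine Finset.sum_congr ?_ fun _ _ => rfl
  ext i
  simp only [Finset.mem_range, Finset.mem_filter]
  exact ⟨fun h => ⟨h.trans_le (hk j), h⟩, fun h => h.2⟩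

lemma abs_sum_indicator_rpow (hα : α ≠ 0) {ι : Type*} [Fintype ι] {I : ι → Set ℝ}
    (hI : Pairwise (fun i j => Disjoint (I i) (I j))) (d : ι → ℝ) (x : ℝ) :
    |∑ i, d i * (I i).indicator 1 x| ^ α = ∑ i, (I i).indicator (fun _ => |d i| ^ α) x := by
  by_cases h : ∃ i, x ∈ I i
  · obtain ⟨i, hi⟩ := h
    have hne : ∀ j, j ≠ i → x ∉ I j := fun j hj h => Set.disjoint_left.1 (hI hj) h hi
    rw [Finset.sum_eq_single i (fun j _ hj => by simp [hne j hj]) (by simp),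
      Finset.sum_eq_single i (fun j _ hj => by simp [hne j hj]) (by simp)]
    simp [hi]
  · push Not at h
    simp [h, Real.zero_rpow hα]

/-- The finite-dimensional characteristic functions of a symmetric stable Lévy process. -/
lemma IsSymmetricStableLevyProcess.integral_exp_sum [IsProbabilityMeasure P] (hα : α ≠ 0)
    {ξ : ℝ≥0 → Ω → ℝ} (hξ : IsSymmetricStableLevyProcess P α ξ) {n : ℕ} (t : Fin n → ℝ≥0)
    (θ : Fin n → ℝ) :
    ∫ ω, Complex.exp ((∑ j, θ j * ξ (t j) ω : ℝ) * Complex.I) ∂P =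
      ((Real.exp (-∫ x, |∑ j, θ j * (Set.Ioc 0 (t j : ℝ)).indicator 1 x| ^ α) : ℝ) : ℂ) := by
  obtain ⟨s, k, hs, hs0, hk⟩ := exists_monotone_seq t
  -- Any common upper bound for the `k j` would do.
  set N := ∑ j, k j
  have hkN : ∀ j, k j ≤ N := fun j => Finset.single_le_sum (fun _ _ => Nat.zero_le _)
    (Finset.mem_univ j)
  set D : Fin N → ℝ := fun i => ∑ j, if (i : ℕ) < k j then θ j else 0
  have hm : ∀ i : Fin N, Measurable fun ω => ξ (s (i + 1)) ω - ξ (s i) ω := fun i =>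
    (hξ.measurable _).sub (hξ.measurable _)
  have hξ0 : ∀ᵐ ω ∂P, ∑ j, θ j * ξ (t j) ω =
      ∑ i : Fin N, D i * (ξ (s (i + 1)) ω - ξ (s i) ω) := by
    filter_upwards [hξ.zero] with ω hω
    simp_rw [hk]
    exact sum_mul_eq_sum_increments θ hkN (f := fun r => ξ r ω) (by rw [hs0]; exact hω)
  have hi : iIndepFun (fun (i : Fin N) ω => D i * (ξ (s (i + 1)) ω - ξ (s i) ω)) P :=
    ((hξ.indep.nat hs).precomp Fin.val_injective).comp (fun i x => D i * x)
      (fun i => measurable_const_mul (D i))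
  have h := congrFun (hi.charFun_map_fun_sum_eq_prod
    (fun i => ((hm i).const_mul _).aemeasurable)) 1
  rw [charFun_apply_real, integral_map (Finset.measurable_sum _
    fun i _ => (hm i).const_mul _).aemeasurable (by fun_prop)] at h
  simp only [Complex.ofReal_one, one_mul] at h
  rw [integral_congr_ae (g := fun ω => Complex.exp
    ((∑ i : Fin N, D i * (ξ (s (i + 1)) ω - ξ (s i) ω) : ℝ) * Complex.I))
    (by filter_upwards [hξ0] with ω hω; rw [hω]), h, Finset.prod_apply]
  have hc : ∀ i : Fin N,
      charFun (P.map fun ω => D i * (ξ (s (i + 1)) ω - ξ (s i) ω)) 1 =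
      ((Real.exp (-(((s (i + 1) : ℝ) - s i) * |D i| ^ α)) : ℝ) : ℂ) := fun i => by
    rw [charFun_map_mul_comp (hm i).aemeasurable, mul_one]
    exact hξ.charFun_eq _ _ (hs (Nat.le_succ i)) _
  simp_rw [hc]
  rw [← Complex.ofReal_prod, ← Real.exp_sum, Finset.sum_neg_distrib]
  have hsub : ∀ (i : Fin N) (x : ℝ), (Set.Ioc 0 (s (i + 1) : ℝ)).indicator (1 : ℝ → ℝ) x -
      (Set.Ioc 0 (s i : ℝ)).indicator 1 x = (Set.Ioc (s i : ℝ) (s (i + 1))).indicator 1 x := by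
    intro i x
    have h1 : (s i : ℝ) ≤ s (i + 1) := by exact_mod_cast hs (Nat.le_succ i)
    have h2 : (0 : ℝ) ≤ s i := (s i).2
    rw [← Set.Ioc_union_Ioc_eq_Ioc h2 h1, Set.indicator_union_of_disjoint
      (Set.Ioc_disjoint_Ioc_of_le le_rfl)]
    ring
  have hd : Pairwise (fun i j : Fin N => Disjoint (Set.Ioc (s i : ℝ) (s (i + 1)))
      (Set.Ioc (s j : ℝ) (s (j + 1)))) := by
    have hlt : ∀ i j : Fin N, i < j → Disjoint (Set.Ioc (s i : ℝ) (s (i + 1)))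
        (Set.Ioc (s j : ℝ) (s (j + 1))) := fun i j hij =>
      Set.Ioc_disjoint_Ioc_of_le (by exact_mod_cast hs (Nat.succ_le_of_lt hij))
    intro i j hij
    exact hij.lt_or_gt.elim (hlt i j) fun h => (hlt j i h).symm
  have hpt : ∀ x, |∑ j, θ j * (Set.Ioc 0 (t j : ℝ)).indicator (1 : ℝ → ℝ) x| ^ α =
      ∑ i : Fin N, (Set.Ioc (s i : ℝ) (s (i + 1))).indicator (fun _ => |D i| ^ α) x := by
    intro x
    rw [← abs_sum_indicator_rpow hα hd]
    simp_rw [hk]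
    rw [sum_mul_eq_sum_increments θ hkN
      (f := fun r : ℝ≥0 => (Set.Ioc 0 (r : ℝ)).indicator (1 : ℝ → ℝ) x) (by simp [hs0])]
    simp_rw [hsub]
    rfl
  simp_rw [hpt]
  rw [integral_finsetSum]
  · congr 3
    refine Finset.sum_congr rfl fun i _ => ?_
    have h1 : (s i : ℝ) ≤ s (i + 1) := by exact_mod_cast hs (Nat.le_succ i)
    rw [integral_indicator_const _ measurableSet_Ioc, Real.volume_real_Ioc_of_le h1, smul_eq_mul]
  · intro i _
    exact (integrable_indicator_iff measurableSet_Ioc).2 (integrableOn_const (by simp))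

lemma charFun_map_toLp {n : ℕ} {W : Ω → Fin n → ℝ} (hW : AEMeasurable W P)
    (θ : EuclideanSpace ℝ (Fin n)) :
    charFun (P.map fun ω => (WithLp.toLp 2 (W ω) : EuclideanSpace ℝ (Fin n))) θ =
      ∫ ω, Complex.exp ((∑ i, θ i * W ω i : ℝ) * Complex.I) ∂P := by
  have hL : AEMeasurable (fun ω => (WithLp.toLp 2 (W ω) : EuclideanSpace ℝ (Fin n))) P :=
    (PiLp.continuous_toLp 2 _).measurable.comp_aemeasurable hW
  rw [charFun_apply, integral_map hL (by fun_prop)]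
  simp [PiLp.inner_apply]

/-- A form of the Lévy continuity theorem for random vectors with values in `Fin n → ℝ`. -/
lemma tendstoInDistribution_pi_of_tendsto_integral_exp {Ω' : Type*} [MeasurableSpace Ω']
    {P' : Measure Ω'} [IsProbabilityMeasure P] [IsProbabilityMeasure P'] {n : ℕ}
    {Y : ℝ → Ω → Fin n → ℝ} {Z : Ω' → Fin n → ℝ} (hY : ∀ T, AEMeasurable (Y T) P)
    (hZ : AEMeasurable Z P')
    (h : ∀ θ : Fin n → ℝ, Tendsto
      (fun T => ∫ ω, Complex.exp ((∑ i, θ i * Y T ω i : ℝ) * Complex.I) ∂P) atTop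
      (𝓝 (∫ ω, Complex.exp ((∑ i, θ i * Z ω i : ℝ) * Complex.I) ∂P'))) :
    TendstoInDistribution Y atTop Z (fun _ => P) P' := by
  have hL : Measurable (WithLp.toLp 2 : (Fin n → ℝ) → EuclideanSpace ℝ (Fin n)) :=
    (PiLp.continuous_toLp 2 _).measurable
  have h' : TendstoInDistribution
      (fun T ω => (WithLp.toLp 2 (Y T ω) : EuclideanSpace ℝ (Fin n))) atTop
      (fun ω => WithLp.toLp 2 (Z ω)) (fun _ => P) P' := by
    refine ⟨fun T => hL.comp_aemeasurable (hY T), hL.comp_aemeasurable hZ, ?_⟩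
    -- The continuity theorem is applied along sequences, which suffices because `atTop` on `ℝ` is
    -- countably generated.
    refine tendsto_iff_seq_tendsto.2 fun u hu => ?_
    refine ProbabilityMeasure.tendsto_of_tendsto_charFun fun θ => ?_
    have h1 : Tendsto (fun k => charFun (P.map fun ω =>
        (WithLp.toLp 2 (Y (u k) ω) : EuclideanSpace ℝ (Fin n))) θ) atTop
        (𝓝 (charFun (P'.map fun ω => (WithLp.toLp 2 (Z ω) : EuclideanSpace ℝ (Fin n))) θ)) := by
      rw [charFun_map_toLp hZ]
      simp_rw [charFun_map_toLp (hY _)]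
      exact (h θ).comp hu
    exact h1
  exact h'.continuous_comp (PiLp.continuous_ofLp 2 _)

/-- The step function associated with a linear combination of values at the times `t j`. -/
def stepWeight {n : ℕ} (t : Fin n → ℝ≥0) (θ : Fin n → ℝ) (x : ℝ) : ℝ :=
  ∑ j, θ j * (Set.Ioc 0 (t j : ℝ)).indicator 1 x

lemma isWeight_stepWeight {n : ℕ} (t : Fin n → ℝ≥0) (θ : Fin n → ℝ) :
    IsWeight (stepWeight t θ) (∑ j, |θ j|) (∑ j, (t j : ℝ)) where
  measurable := Finset.measurable_sum _ fun j _ =>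
    measurable_const.mul (measurable_const.indicator measurableSet_Ioc)
  abs_le s := by
    refine (Finset.abs_sum_le_sum_abs _ _).trans (Finset.sum_le_sum fun j _ => ?_)
    rw [abs_mul]
    refine mul_le_of_le_one_right (abs_nonneg _) ?_
    by_cases hs : s ∈ Set.Ioc 0 (t j : ℝ)
    · simp [Set.indicator_of_mem hs]
    · simp [Set.indicator_of_notMem hs]
  eq_zero s hs := by
    refine Finset.sum_eq_zero fun j _ => ?_
    rw [Set.indicator_of_notMem, mul_zero]
    refine fun h => hs ⟨h.1, h.2.trans ?_⟩
    exact Finset.single_le_sum (f := fun j => (t j : ℝ)) (fun _ _ => NNReal.coe_nonneg _)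
      (Finset.mem_univ j)

lemma sum_mul_rescaledIntegral {Ω' : Type*} {X : ℝ → Ω' → ℝ} {n : ℕ} (t : Fin n → ℝ≥0) (θ : Fin n → ℝ) (F : ℝ → ℝ) {T : ℝ}
    (hT : 0 < T) {ω : Ω'} (hω : ∀ M, IntegrableOn (fun s => X s ω) (Set.Ioc 0 M)) :
    ∑ j, θ j * rescaledIntegral F X T (t j) ω =
      ∫ s in Set.Ioc 0 (T * ∑ j, (t j : ℝ)), (1 / F T * stepWeight t θ (s / T)) * X s ω := by
  have hle : ∀ j, (t j : ℝ) ≤ ∑ j, (t j : ℝ) := fun j =>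
    Finset.single_le_sum (f := fun j => (t j : ℝ)) (fun _ _ => NNReal.coe_nonneg _)
      (Finset.mem_univ j)
  have hind : ∀ (j : Fin n) (s : ℝ),
      1 / F T * (θ j * (Set.Ioc 0 (t j : ℝ)).indicator 1 (s / T)) * X s ω =
      (1 / F T * θ j) * (Set.Ioc 0 (T * (t j : ℝ))).indicator (fun s => X s ω) s := by
    intro j s
    have : s / T ∈ Set.Ioc 0 (t j : ℝ) ↔ s ∈ Set.Ioc 0 (T * (t j : ℝ)) := by
      simp [hT, div_le_iff₀' hT]
    by_cases hs : s ∈ Set.Ioc 0 (T * (t j : ℝ))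
    · rw [Set.indicator_of_mem hs, Set.indicator_of_mem (this.2 hs), Pi.one_apply]
      ring
    · rw [Set.indicator_of_notMem hs, Set.indicator_of_notMem (fun h => hs (this.1 h))]
      ring
  simp_rw [stepWeight, Finset.mul_sum, Finset.sum_mul, hind]
  rw [← Finset.mul_sum, integral_finsetSum]
  · refine Finset.sum_congr rfl fun j _ => ?_
    rw [integral_const_mul, setIntegral_indicator measurableSet_Ioc,
      Set.inter_eq_right.2 (Set.Ioc_subset_Ioc_right (by have := hle j; gcongr)),
      rescaledIntegral, intervalIntegral.integral_of_le (by positivity)]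
    ring
  · exact fun j _ => ((hω _).indicator measurableSet_Ioc).const_mul _

lemma IsTrawlProcess.measurable_rescaledIntegral [SFinite P] (hX : IsTrawlProcess P Λ g X)
    (F : ℝ → ℝ) (T : ℝ) (t : ℝ≥0) : Measurable (rescaledIntegral F X T t) := by
  have h := fun S => hX.measurable_setIntegral (P := P) (w := fun _ => 1) measurable_const
    measurable_id S
  simp only [one_mul, id] at h
  unfold rescaledIntegral intervalIntegral
  exact ((h _).sub (h _)).const_mul _

/-- Convergence of the finite-dimensional distributions of the rescaled integrated process. -/
lemma IsTrawlProcess.tendstoFDD {Ω' : Type*} [MeasurableSpace Ω'] {P' : Measure Ω'}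
    [IsProbabilityMeasure P] [IsProbabilityMeasure P'] (hX : IsTrawlProcess P Λ g X)
    (hg : AssumptionG g γ Cg) (hα : α = 1 + γ)
    (hΛ : IsLevyBasis P ν Λ) (hψ : ∀ θ : ℝ, levyExponent ν θ = |θ| ^ α) {ξ : ℝ≥0 → Ω' → ℝ}
    (hξ : IsSymmetricStableLevyProcess P' α ξ) :
    TendstoFDD (rescaledIntegral (fun T : ℝ => (T * Real.log T) ^ (1 / α)) X)
      (fun t ω => Cg ^ (1 / α) * ξ t ω) P P' := by
  have hα1 : 1 < α := by linarith [hg.gamma_pos]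
  have hα0 : 0 < α := by linarith
  have hCg := hg.const_pos
  intro n t
  refine tendstoInDistribution_pi_of_tendsto_integral_exp
    (fun T => (measurable_pi_lambda _ fun j =>
      hX.measurable_rescaledIntegral (P := P) _ T (t j)).aemeasurable)
    (measurable_pi_lambda _ fun j => (hξ.measurable (t j)).const_mul _).aemeasurable fun θ => ?_
  have hw := isWeight_stepWeight t θ
  have hM : (0 : ℝ) ≤ ∑ j, (t j : ℝ) := Finset.sum_nonneg fun _ _ => NNReal.coe_nonneg _
  have hlimit : ∫ ω, Complex.exp ((∑ i, θ i * (Cg ^ (1 / α) * ξ (t i) ω) : ℝ) * Complex.I) ∂P' =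
      ((Real.exp (-(Cg * ∫ x, |stepWeight t θ x| ^ α)) : ℝ) : ℂ) := by
    have h := hξ.integral_exp_sum hα0.ne' t (fun j => θ j * Cg ^ (1 / α))
    simp_rw [← mul_assoc]
    rw [h, ← integral_const_mul]
    congr 4
    ext x
    have : ∑ j, θ j * Cg ^ (1 / α) * (Set.Ioc 0 (t j : ℝ)).indicator (1 : ℝ → ℝ) x =
        Cg ^ (1 / α) * stepWeight t θ x := by
      rw [stepWeight, Finset.mul_sum]
      exact Finset.sum_congr rfl fun j _ => by ring
    rw [this, abs_mul, Real.mul_rpow (abs_nonneg _) (abs_nonneg _),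
      abs_of_nonneg (by positivity), ← Real.rpow_mul hCg.le, one_div_mul_cancel hα0.ne',
      Real.rpow_one]
  rw [hlimit]
  refine Tendsto.congr' ?_ ((Complex.continuous_ofReal.tendsto _).comp
    ((Real.continuous_exp.tendsto _).comp (hw.tendsto_integral_trawl hM hg hα).neg))
  filter_upwards [eventually_gt_atTop 0] with T hT
  have h := hX.integral_exp_setIntegral hg hα1 hΛ hψ
    (measurable_const_mul_comp_div hw.measurable (1 / (T * Real.log T) ^ (1 / α)) T)
    (C := |1 / (T * Real.log T) ^ (1 / α)| * ∑ j, |θ j|)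
    (fun s => by rw [abs_mul]; exact mul_le_mul_of_nonneg_left (hw.abs_le _) (abs_nonneg _))
    (mul_nonneg hT.le hM)
  simp only [Function.comp_apply]
  rw [← h]
  refine integral_congr_ae ?_
  filter_upwards [hX.ae_integrableOn hg hα1 hΛ hψ] with ω hω
  rw [sum_mul_rescaledIntegral t θ _ hT hω]

end

end Trawl

end

theorem theorem2p10 {Ω : Type*} [MeasurableSpace Ω] (P : Measure Ω)
    [IsProbabilityMeasure P]
    (g : ℝ → ℝ) (γ Cg α : ℝ) (hg : Trawl.AssumptionG g γ Cg) (hα : α = 1 + γ)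
    (Λ : Set (ℝ × ℝ) → Ω → ℝ) (hΛ : Trawl.IsSymmetricStableRandomMeasure P α Λ)
    (X : ℝ → Ω → ℝ) (hX : Trawl.IsTrawlProcess P Λ g X) :
    -- the paths of the trawl process are locally integrable, so that `Y_T` is well defined
    (∀ᵐ ω ∂P, ∀ t : ℝ, 0 ≤ t → IntervalIntegrable (fun s => X s ω) volume 0 t) ∧
    -- symmetric `α`-stable Lévy processes exist
    (∃ ξ : ℝ≥0 → Ω → ℝ, Trawl.IsSymmetricStableLevyProcess P α ξ) ∧
    -- convergence to a positive multiple of any such process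
    ∃ K : ℝ, 0 < K ∧
      ∀ {Ω' : Type*} [MeasurableSpace Ω'] (P' : Measure Ω') [IsProbabilityMeasure P']
        (ξ : ℝ≥0 → Ω' → ℝ), Trawl.IsSymmetricStableLevyProcess P' α ξ →
        Trawl.TendstoFDD
          (Trawl.rescaledIntegral (fun T : ℝ => (T * Real.log T) ^ (1 / α)) X)
          (fun t ω => K * ξ t ω) P P' := by
  have hα1 : 1 < α := by linarith [hg.gamma_pos]
  obtain ⟨ν, hν, hψ⟩ := hΛ
  -- Multiplying `ξ` by `K` multiplies its exponent by `K^α`, which has to equal `Cg`.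
  refine ⟨?_, hν.exists_stableLevyProcess hψ, Cg ^ (1 / α), Real.rpow_pos_of_pos hg.const_pos _,
    fun P' _ ξ hξ => hX.tendstoFDD hg hα hν hψ hξ⟩
  filter_upwards [hX.ae_integrableOn hg hα1 hν hψ] with ω hω t ht
  exact (intervalIntegrable_iff_integrableOn_Ioc_of_le ht).2 (hω t)
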